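/- **Setting.** For $v\in\mathbb R^d$ write $\|v\|_1=\sum_j|v_j|$, $\|v\|_\infty=\max_j|v_j|$, and $\|v\|_2$ for the Euclidean norm. Let $\xi_1,\xi_2,\dots$ be i.i.d. samples from a distribution $\mathcal D$, let $F(x)=\mathbb E_{\xi\sim\mathcal D}[f(x,\xi)]$ on $\mathbb R^d$, and assume that for every $x$ the stochastic gradient $\nabla f(x,\xi)$ (in $x$) exists for almost every $\xi$ and is an unbiased estimate of $\nabla F(x)$. Generalized SignSGD with inputs $x_1,\beta_1,\beta_2,\eta$ starts from $m_0=v_0=0$ and iterates, for $t=1,2,\dots,T$, coordinate-wise, $$g_t=\nabla f(x_t,\xi_t),\quad m_t=\beta_1m_{t-1}+(1-\beta_1)g_t,\quad v_t=\beta_2v_{t-1}+(1-\beta_2)m_t^2,\quad x_{t+1}=x_t-\eta\,\frac{m_t}{\sqrt{v_t}},$$ where $0/0=0$. **Assumptions.** (1) $F$ is differentiable and bounded below, with infimum $F^*$. (2) $F$ is twice differentiable and coordinate-wise $(L_0,L_1)$-smooth for vectors $L_0,L_1\in\mathbb R^d$, $\|L_0\|_1>0$: for all $x,y$ with $\|L_1\|_\infty\|x-y\|_2\le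 1$ and all $j$, $$\left|\frac{\partial F}{\partial x_j}(y)-\frac{\partial F}{\partial x_j}(x)\right|\le\left(\frac{L_{0,j}}{\sqrt d}+L_{1,j}\left|\frac{\partial F}{\partial x_j}(x)\right|\right)\|y-x\|_2 .$$ (3) There is $\sigma\in(0,\infty)^d$ such that for every $j$ and $x$, $\left|[\nabla f(x,\xi)]_j-\frac{\partial F}{\partial x_j}(x)\right|\le\sigma_j$ for almost every $\xi\sim\mathcal D$. **Parameters.** Let $T\ge1$ be an integer, $\delta\in(0,1)$, $\Delta\ge F(x_1)-F^*$, $$\alpha=\min\left(\frac{\sqrt{\|L_0\|_1}\sqrt\Delta}{\|\sigma\|_1\sqrt T},1\right),\quad \beta_1=1-\alpha,\quad \eta=\frac{\sqrt{\Delta\alpha}}{\sqrt{\|L_0\|_1}\sqrt T},$$ let $\beta_2\ge0$ satisfy $\beta_2=0$ or $\sqrt{\beta_2}<\beta_1$, and let $\rho=1-\sqrt{\beta_2}/\beta_1$ (so $\rho=1$ if $\beta_2=0$). Assume $$T\ge\max\left(\frac{100\,d\,\Delta\|L_1\|_\infty^2}{(1-\beta_2)\rho^2\|L_0\|_1},\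 \frac{10000\,d^2\Delta\|\sigma\|_1^2\|L_1\|_\infty^4}{(1-\beta_2)^2\rho^4\|L_0\|_1^3}\right).$$ **Theorem.** There is an absolute constant $C>0$ such that in this setting the following two guarantees hold. (a) If $M_j:=\sup\{|\frac{\partial F}{\partial x_j}(x)|:F(x)\le F(x_1)\}$ is finite for every $j$, and $M=(M_1,\dots,M_d)$, then with probability at least $1-\delta$ $$\min_{1\le t\le T}\|\nabla F(x_t)\|_1\le C\left(\frac{\sqrt{\log(dT/\delta)}\,\|L_0\|_1^{1/4}\Delta^{1/4}\|\sigma\|_1^{1/2}}{\rho\sqrt{1-\beta_2}\,T^{1/4}}+\frac{\log(dT/\delta)\sqrt{\|L_0\|_1\Delta}}{\rho\sqrt T}\right)$$ $$\qquad+\,C\left(\frac{\|M\|_1+\|\sigma\|_1}{\rho}\exp\left(-\frac{\sqrt{1-\beta_2}\,\|L_0\|_1^{3/4}}{\sqrt d\,\|L_1\|_\infty\|\sigma\|_1^{1/2}\Delta^{1/4}}T^{1/4}\right)+\frac{\|\nabla F(x_1)\|_1}{T}\right),$$ where the exponential is read as $0$ if $L_1=0$ or $\Delta=0$. (b) If $\beta_2=0$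 (SignSGD with momentum), then, without assuming that the $M_j$ are finite, with probability at least $1-\delta$ $$\min_{1\le t\le T}\|\nabla F(x_t)\|_1\le C\left(\frac{\sqrt{\log(dT/\delta)}\,\|L_0\|_1^{1/4}\Delta^{1/4}\|\sigma\|_1^{1/2}}{T^{1/4}}+\frac{\log(dT/\delta)\sqrt{\|L_0\|_1\Delta}}{\sqrt T}\right)$$ $$\qquad+\,C\left(\frac{\|\nabla F(x_1)\|_1}{\sqrt T}\left(\frac1{\sqrt T}+\frac{\|\sigma\|_1}{\sqrt{\|L_0\|_1\Delta}}\right)+\frac{\|\sigma\|_1}{T}\right)$$ (if $\Delta=0$, then $\nabla F(x_1)=0$ and the term containing $\|\nabla F(x_1)\|_1$ is read as $0$). -/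

import Mathlib

open MeasureTheory ProbabilityTheory

noncomputable section

/-- The `ℓ₁` norm `∑ⱼ |vⱼ|` of a vector. (The `ℓ_∞` norm of `v : Fin d → ℝ` is Mathlib's `‖v‖`, and
the Euclidean norm is the norm of `EuclideanSpace ℝ (Fin d)`.) -/
def l1Norm {d : ℕ} (v : Fin d → ℝ) : ℝ := ∑ j, |v j|

/-- `F` is twice differentiable and coordinate-wise `(L₀, L₁)`-smooth. The condition
`‖x - y‖ ≤ 1 / ‖L₁‖_∞` is written without a division, so that it is no restriction when `L₁ = 0`. -/
structure CoordSmooth {d : ℕ} (L₀ L₁ : Fin d → ℝ) (F : EuclideanSpace ℝ (Fin d) → ℝ) : Prop where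
  differentiable : Differentiable ℝ F
  differentiable_gradient : Differentiable ℝ (gradient F)
  smooth : ∀ x y : EuclideanSpace ℝ (Fin d), ‖L₁‖ * ‖x - y‖ ≤ 1 → ∀ j,
    |gradient F y j - gradient F x j|
      ≤ (L₀ j / √(d : ℝ) + L₁ j * |gradient F x j|) * ‖y - x‖

/-- The stochastic gradient `∇f(x, ξ)`, the gradient being taken in `x`. -/
def stochGrad {d : ℕ} {Ξ : Type*} (f : EuclideanSpace ℝ (Fin d) → Ξ → ℝ)
    (x : EuclideanSpace ℝ (Fin d)) (ξ : Ξ) : EuclideanSpace ℝ (Fin d) :=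
  gradient (fun y => f y ξ) x

/-- `F(x) = 𝔼_{ξ ∼ 𝒟} f(x, ξ)`, and `∇f(x, ξ)`, which exists for almost every `ξ`, is a measurable
and unbiased estimate of `∇F(x)`. -/
structure IsStochasticObjective {d : ℕ} {Ξ : Type*} [MeasurableSpace Ξ] (𝒟 : Measure Ξ)
    (f : EuclideanSpace ℝ (Fin d) → Ξ → ℝ) (F : EuclideanSpace ℝ (Fin d) → ℝ) : Prop where
  integrable : ∀ x, Integrable (f x) 𝒟
  eq_integral : ∀ x, F x = ∫ ξ, f x ξ ∂𝒟
  differentiableAt : ∀ x, ∀ᵐ ξ ∂𝒟, DifferentiableAt ℝ (fun y => f y ξ) x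
  measurable_grad : Measurable fun p : EuclideanSpace ℝ (Fin d) × Ξ => stochGrad f p.1 p.2
  integrable_grad : ∀ x, Integrable (stochGrad f x) 𝒟
  unbiased : ∀ x, ∫ ξ, stochGrad f x ξ ∂𝒟 = gradient F x

/-- Coordinate-wise almost surely bounded noise. -/
def BoundedNoise {d : ℕ} {Ξ : Type*} [MeasurableSpace Ξ] (𝒟 : Measure Ξ)
    (f : EuclideanSpace ℝ (Fin d) → Ξ → ℝ) (F : EuclideanSpace ℝ (Fin d) → ℝ)
    (σ : Fin d → ℝ) : Prop :=
  ∀ j, 0 < σ j ∧ ∀ x, ∀ᵐ ξ ∂𝒟, |stochGrad f x ξ j - gradient F x j| ≤ σ j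

/-- The variables of the algorithm after iteration `t`: the point `x_{t+1}`, the momentum `m_t` and
the second-moment estimate `v_t`. -/
structure SignState (d : ℕ) where
  x : EuclideanSpace ℝ (Fin d)
  m : Fin d → ℝ
  v : Fin d → ℝ

/-- One iteration of generalized SignSGD, all vector operations being coordinate-wise; `g` maps a
point to the stochastic gradient used there. Lean's `0 / 0 = 0` means that a coordinate with
`m = v = 0` is left unchanged, that is, `sign 0 = 0` when `β₂ = 0`. -/
def signStep {d : ℕ} (β₁ β₂ η : ℝ) (g : EuclideanSpace ℝ (Fin d) → EuclideanSpace ℝ (Fin d))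
    (s : SignState d) : SignState d :=
  let m' : Fin d → ℝ := fun j => β₁ * s.m j + (1 - β₁) * g s.x j
  let v' : Fin d → ℝ := fun j => β₂ * s.v j + (1 - β₂) * m' j ^ 2
  { x := WithLp.toLp 2 fun j => s.x j - η * (m' j / √(v' j))
    m := m'
    v := v' }

/-- The state after `t` iterations, from `x₁`, `m₀ = 0`, `v₀ = 0`; iteration `t` uses the sample
`ξ t`. -/
def signRun {d : ℕ} {Ξ : Type*} (f : EuclideanSpace ℝ (Fin d) → Ξ → ℝ) (β₁ β₂ η : ℝ)
    (x₁ : EuclideanSpace ℝ (Fin d)) (ξ : ℕ → Ξ) : ℕ → SignState d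
  | 0 => { x := x₁, m := 0, v := 0 }
  | t + 1 => signStep β₁ β₂ η (fun x => stochGrad f x (ξ (t + 1))) (signRun f β₁ β₂ η x₁ ξ t)

/-- The iterate `x_t`, `t ≥ 1`, of generalized SignSGD. -/
def signIter {d : ℕ} {Ξ : Type*} (f : EuclideanSpace ℝ (Fin d) → Ξ → ℝ) (β₁ β₂ η : ℝ)
    (x₁ : EuclideanSpace ℝ (Fin d)) (ξ : ℕ → Ξ) (t : ℕ) : EuclideanSpace ℝ (Fin d) :=
  (signRun f β₁ β₂ η x₁ ξ (t - 1)).x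

/-- The set of `|∂F/∂x_j (x)|` over the points `x` of the sublevel set of `F(x₁)`. -/
def sublevelPartials {d : ℕ} (F : EuclideanSpace ℝ (Fin d) → ℝ) (x₁ : EuclideanSpace ℝ (Fin d))
    (j : Fin d) : Set ℝ :=
  {r | ∃ x, F x ≤ F x₁ ∧ r = |gradient F x j|}

/-- `M_j`, the supremum of `|∂F/∂x_j|` over the sublevel set of `F(x₁)`. -/
def sublevelBound {d : ℕ} (F : EuclideanSpace ℝ (Fin d) → ℝ) (x₁ : EuclideanSpace ℝ (Fin d))
    (j : Fin d) : ℝ :=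
  sSup (sublevelPartials F x₁ j)

/-- `exp (-a / b)` for `a > 0` and `b ≥ 0`, with the value `exp (-∞) = 0` at `b = 0`. -/
def expNegDiv (a b : ℝ) : ℝ := if b = 0 then 0 else Real.exp (-(a / b))

end

/-! The momentum is an exponential average of true gradients plus the same average of the noise.
Given the past, the noise is centred and bounded, so its average is sub-Gaussian with variance proxy
`α σ_j²`, where `α = 1 - β₁`. A union bound over coordinates and times gives an event of probability
at least `1 - δ` on which every averaged noise is at most `E j`, of order `σ_j √(α log(dT/δ))`. The
rest is deterministic.

Every coordinate moves by at most `r = η / √(1 - β₂)` per step, and the lower bound on `T` makes the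
relative drift of a partial derivative at most `α ρ / 10` per step, where `ρ = 1 - κ` and `κ = √β₂ /
β₁`. So over the memory `1 / α` of the average, gradients change little. Once `1 / α` steps have
passed, a coordinate that is large compared with drift and noise gets an update of the right sign
and of size at least `ρ / (4 √(1 - β₂))` (`update_ge_of_pos`). Small coordinates cost only an error
(`update_correlation`). Hence late steps decrease `F` in proportion to `ρ ‖∇F‖₁`, up to that error
(`signRun_sub_le_late`). Each of the at most `1 / α` early steps may increase `F` by an amount
controlled by `‖∇F(x₁)‖₁`. Telescoping gives `signRun_min_bound`.

The early cost is absorbed because smoothness and `F x₁ - inf F ≤ Δ` already bound `‖∇F(x₁)‖₁`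
(`CoordSmooth.l1Norm_gradient_le`). With the prescribed `α` and `η`, what remains is the main rate
alone (`signRun_min_le`, `SignParams.rate_bound`). The other terms of both guarantees are
nonnegative; the one in `∇F(x₁)` serves only when `T = 1` or `Δ = 0`. -/

/-! ### Scalar sequences: drift, exponential averages and the normalized update -/

/-- A discrete Grönwall inequality. It is applied forwards in time to the early phase, and backwards
to compare past gradients with the current one. -/
theorem abs_sub_le_of_relative_steps {h : ℕ → ℝ} {b q : ℝ} {n : ℕ} (hb : 0 ≤ b) (hq : 0 ≤ q)
    (hstep : ∀ i < n, |h (i + 1) - h i| ≤ b + q * |h i|) :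
    ∀ k ≤ n, |h k - h 0| ≤ k * (1 + q) ^ k * (b + q * |h 0|) := by
  intro k
  induction k with
  | zero => simp
  | succ k ih =>
    intro hk
    have h1 := ih (by omega)
    have h2 := hstep k (by omega)
    have h3 : |h k| ≤ |h 0| + |h k - h 0| := by
      have := abs_add_le (h 0) (h k - h 0); simpa using this
    have h4 : |h (k + 1) - h 0| ≤ |h (k + 1) - h k| + |h k - h 0| := abs_sub_le _ _ _
    have h5 : (1 : ℝ) ≤ (1 + q) ^ (k + 1) := one_le_pow₀ (by linarith)
    have hc : 0 ≤ b + q * |h 0| := by positivity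
    calc |h (k + 1) - h 0| ≤ (b + q * |h 0|) + (1 + q) * |h k - h 0| := by nlinarith
      _ ≤ (1 + q) ^ (k + 1) * (b + q * |h 0|)
            + (1 + q) * (k * (1 + q) ^ k * (b + q * |h 0|)) := by
          gcongr
          exact le_mul_of_one_le_left hc h5
      _ = _ := by push_cast; ring

/-- The exponential moving average of `g`, started from zero. -/
def expAvg (β : ℝ) (g : ℕ → ℝ) : ℕ → ℝ
  | 0 => 0
  | t + 1 => β * expAvg β g t + (1 - β) * g t

theorem expAvg_add (β : ℝ) (g h : ℕ → ℝ) (t : ℕ) :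
    expAvg β (fun s => g s + h s) t = expAvg β g t + expAvg β h t := by
  induction t with
  | zero => simp [expAvg]
  | succ t ih => simp only [expAvg, ih]; ring

theorem expAvg_neg (β : ℝ) (g : ℕ → ℝ) (t : ℕ) :
    expAvg β (fun s => -g s) t = -expAvg β g t := by
  induction t with
  | zero => simp [expAvg]
  | succ t ih => simp only [expAvg, ih]; ring

theorem expAvg_unroll (β : ℝ) (g : ℕ → ℝ) (t : ℕ) {k : ℕ} (hk : k ≤ t + 1) :
    expAvg β g (t + 1) = β ^ k * expAvg β g (t + 1 - k)
      + (1 - β) * ∑ i ∈ Finset.range k, β ^ i * g (t - i) := by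
  induction k with
  | zero => simp
  | succ k ih =>
    rw [ih (by omega), Finset.sum_range_succ, show t + 1 - k = (t - k) + 1 by omega,
      show t + 1 - (k + 1) = t - k by omega]
    simp only [expAvg]; ring

theorem one_sub_mul_sum_pow (β : ℝ) (k : ℕ) :
    (1 - β) * ∑ i ∈ Finset.range k, β ^ i = 1 - β ^ k := by
  have := geom_sum_mul β k
  linarith

theorem sum_mul_pow_le {r : ℝ} (h0 : 0 ≤ r) (h1 : r < 1) (k : ℕ) :
    ∑ i ∈ Finset.range k, (i : ℝ) * r ^ i ≤ r / (1 - r) ^ 2 :=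
  sum_le_hasSum _ (fun i _ => by positivity)
    (hasSum_coe_mul_geometric_of_norm_lt_one (by rwa [Real.norm_of_nonneg h0]))

/-- The value `i` steps back differs from `g t` by at most `i (1 + q)^i c`. Against the weights
`β^i` this is an arithmetic-geometric series of ratio `β (1 + q)`, whose gap to `1` is still
comparable to `1 - β`. -/
theorem abs_window_sub_le {β b q : ℝ} {g : ℕ → ℝ} {t k : ℕ} (hβ : 0 ≤ β) (hβ1 : β < 1)
    (hb : 0 ≤ b) (hq : 0 ≤ q) (hq1 : q ≤ (1 - β) / 10)
    (hstep : ∀ s < t, |g s - g (s + 1)| ≤ b + q * |g (s + 1)|) (hk : k ≤ t + 1) :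
    |(1 - β) * ∑ i ∈ Finset.range k, β ^ i * g (t - i) - (1 - β ^ k) * g t|
      ≤ 5 / 4 * ((b + q * |g t|) / (1 - β)) := by
  set c := b + q * |g t| with hc
  have hc0 : 0 ≤ c := by positivity
  have hα : 0 < 1 - β := by linarith
  have hdrift : ∀ i ≤ t, |g (t - i) - g t| ≤ i * (1 + q) ^ i * c := by
    intro i hi
    have := abs_sub_le_of_relative_steps (h := fun i => g (t - i)) (n := t) hb hq
      (fun i hi => by
        have := hstep (t - (i + 1)) (by omega)
        rwa [show t - (i + 1) + 1 = t - i by omega] at this) i hi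
    simpa using this
  set r := β * (1 + q) with hr
  have hr0 : 0 ≤ r := by positivity
  have hr1 : 9 / 10 * (1 - β) ≤ 1 - r := by nlinarith
  have hr2 : r < 1 := by linarith
  rw [← one_sub_mul_sum_pow, mul_assoc, ← mul_sub, Finset.sum_mul, ← Finset.sum_sub_distrib,
    abs_mul, abs_of_pos hα]
  have hsum : |∑ i ∈ Finset.range k, (β ^ i * g (t - i) - β ^ i * g t)|
      ≤ (∑ i ∈ Finset.range k, (i : ℝ) * r ^ i) * c := by
    rw [Finset.sum_mul]
    refine (Finset.abs_sum_le_sum_abs _ _).trans (Finset.sum_le_sum fun i hi => ?_)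
    have hi' : i ≤ t := by have := Finset.mem_range.1 hi; omega
    rw [← mul_sub, abs_mul, abs_of_nonneg (pow_nonneg hβ i)]
    calc β ^ i * |g (t - i) - g t| ≤ β ^ i * (i * (1 + q) ^ i * c) := by
          gcongr; exact hdrift i hi'
      _ = _ := by rw [hr, mul_pow]; ring
  -- The constant is `1 / 0.9² < 5 / 4`, from `1 - r ≥ 0.9 (1 - β)`.
  have hgeo : ∑ i ∈ Finset.range k, (i : ℝ) * r ^ i ≤ 5 / 4 / (1 - β) ^ 2 := by
    refine (sum_mul_pow_le hr0 hr2 k).trans ?_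
    rw [div_le_div_iff₀ (by nlinarith) (by positivity)]
    nlinarith [mul_self_le_mul_self (by positivity) hr1, mul_nonneg hr0 (sq_nonneg (1 - β))]
  calc (1 - β) * |∑ i ∈ Finset.range k, (β ^ i * g (t - i) - β ^ i * g t)|
      ≤ (1 - β) * (5 / 4 / (1 - β) ^ 2 * c) := by
        gcongr
        exact hsum.trans (by gcongr)
    _ = _ := by field_simp

/-- Subadditivity of the square root, unrolled along the recursion. It makes the denominator linear
in the momenta, so that they can be compared with the current one. -/
theorem sqrt_secondMoment_le {β₂ : ℝ} {m v : ℕ → ℝ} (h0 : 0 ≤ β₂) (h1 : β₂ ≤ 1) (hv0 : v 0 = 0)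
    (hv : ∀ s, v (s + 1) = β₂ * v s + (1 - β₂) * m (s + 1) ^ 2) (t : ℕ) :
    0 ≤ v t ∧ √(v t) ≤ √(1 - β₂) * ∑ k ∈ Finset.range t, √β₂ ^ k * |m (t - k)| := by
  induction t with
  | zero => simp [hv0]
  | succ t ih =>
    obtain ⟨hvt, ih⟩ := ih
    have h1' : 0 ≤ 1 - β₂ := by linarith
    have hstep : √(v (t + 1)) ≤ √β₂ * √(v t) + √(1 - β₂) * |m (t + 1)| := by
      rw [hv]
      rw [← Real.sqrt_sq_eq_abs, ← Real.sqrt_mul h0, ← Real.sqrt_mul h1']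
      have ha := Real.sq_sqrt (mul_nonneg h0 hvt)
      have hb := Real.sq_sqrt (mul_nonneg h1' (sq_nonneg (m (t + 1))))
      refine Real.sqrt_le_iff.2 ⟨by positivity, ?_⟩
      nlinarith [mul_nonneg (Real.sqrt_nonneg (β₂ * v t))
        (Real.sqrt_nonneg ((1 - β₂) * m (t + 1) ^ 2))]
    refine ⟨by rw [hv]; positivity, hstep.trans ?_⟩
    rw [Finset.sum_range_succ']
    have : √β₂ * √(v t) ≤ √β₂ * (√(1 - β₂) * ∑ k ∈ Finset.range t, √β₂ ^ k * |m (t - k)|) := by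
      gcongr
    refine (add_le_add_left this _).trans_eq ?_
    simp only [pow_succ, Nat.add_sub_add_right, mul_add, Finset.mul_sum]
    simp only [pow_zero, one_mul, Nat.sub_zero]
    congr 1
    exact Finset.sum_congr rfl fun k _ => by ring

theorem abs_update_le {β₂ : ℝ} {m v : ℕ → ℝ} (h0 : 0 ≤ β₂) (h1 : β₂ ≤ 1) (hv0 : v 0 = 0)
    (hv : ∀ s, v (s + 1) = β₂ * v s + (1 - β₂) * m (s + 1) ^ 2) (t : ℕ) :
    √(1 - β₂) * |m (t + 1) / √(v (t + 1))| ≤ 1 := by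
  have hvt := (sqrt_secondMoment_le h0 h1 hv0 hv t).1
  have h1' : 0 ≤ 1 - β₂ := by linarith
  have : √(1 - β₂) * |m (t + 1)| ≤ √(v (t + 1)) := by
    rw [← Real.sqrt_sq_eq_abs, ← Real.sqrt_mul h1', hv]
    exact Real.sqrt_le_sqrt (by nlinarith [mul_nonneg h0 hvt])
  rw [abs_div, abs_of_nonneg (Real.sqrt_nonneg (v (t + 1))), ← mul_div_assoc]
  exact div_le_one_of_le₀ this (Real.sqrt_nonneg _)

/-- The risk is a denominator dominated by large old momenta. But `β₁^k` times the momentum `k`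
steps ago is part of the current momentum up to the window sum, hence at most `A + 2S + E`. Since
`√β₂ = κ β₁`, the denominator is a geometric series in `κ` of such terms, which costs only `1 / (1 -
κ)`. -/
theorem update_ge_of_pos {β₁ β₂ κ b q E : ℝ} {g n m v : ℕ → ℝ} {t : ℕ}
    (hβ : 0 ≤ β₁) (hβ1 : β₁ < 1) (h0 : 0 ≤ β₂) (h1 : β₂ < 1) (hκ : 0 ≤ κ) (hκ1 : κ < 1)
    (hκβ : √β₂ = κ * β₁) (hb : 0 ≤ b) (hE : 0 ≤ E) (hq : q = (1 - β₁) * (1 - κ) / 10)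
    (hm : ∀ s, m s = expAvg β₁ g s + expAvg β₁ n s) (hN : ∀ s ≤ t + 1, |expAvg β₁ n s| ≤ E)
    (hv0 : v 0 = 0) (hv : ∀ s, v (s + 1) = β₂ * v s + (1 - β₂) * m (s + 1) ^ 2)
    (hstep : ∀ s < t, |g s - g (s + 1)| ≤ b + q * |g (s + 1)|)
    (hlate : β₁ ^ (t + 1) ≤ 37 / 100) (hg : 0 < g t)
    (hbig : 20 * (b / (1 - β₁) + E) ≤ g t) :
    (1 - κ) / 4 ≤ √(1 - β₂) * (m (t + 1) / √(v (t + 1))) := by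
  set B := b / (1 - β₁) with hB
  set S := 5 / 4 * ((b + q * |g t|) / (1 - β₁)) with hS
  have hα : 0 < 1 - β₁ := by linarith
  have hρ : 0 < 1 - κ := by linarith
  have hB0 : 0 ≤ B := by positivity
  have hq0 : 0 ≤ q := by rw [hq]; positivity
  have hq1 : q ≤ (1 - β₁) / 10 := by rw [hq]; nlinarith
  have hSle : S ≤ 1 / 8 * g t + 5 / 4 * B := by
    have : S = 5 / 4 * B + 1 / 8 * (1 - κ) * g t := by
      rw [hS, hB, hq, abs_of_pos hg]; field_simp; ring
    nlinarith
  have hS0 : 0 ≤ S := by positivity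
  have hwin := fun k (hk : k ≤ t + 1) =>
    abs_window_sub_le (k := k) hβ hβ1 hb hq0 hq1 hstep hk
  set A := expAvg β₁ g (t + 1) with hA
  have hAfull : |A - (1 - β₁ ^ (t + 1)) * g t| ≤ S := by
    have h := hwin (t + 1) le_rfl
    have h' := expAvg_unroll β₁ g t (k := t + 1) le_rfl
    simp only [Nat.sub_self, expAvg, mul_zero, zero_add] at h'
    rw [hA]; simp only [expAvg]; rw [h']; exact h
  have hpow0 : 0 ≤ β₁ ^ (t + 1) := by positivity
  obtain ⟨hA1, hA2⟩ := abs_le.1 hAfull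
  -- The old part is `A` minus the window sum, which is within `S` of `(1 - β₁^k) g t`, while `A` is
  -- within `S` of `(1 - β₁^(t+1)) g t`.
  have hAold : ∀ k ≤ t, β₁ ^ k * |expAvg β₁ g (t + 1 - k)| ≤ A + 2 * S := by
    intro k hk
    have h := hwin k (by omega)
    have h' := expAvg_unroll β₁ g t (k := k) (by omega)
    obtain ⟨h2, h3⟩ := abs_le.1 h
    have hk1 : β₁ ^ k ≤ 1 := pow_le_one₀ hβ hβ1.le
    have hkt : β₁ ^ (t + 1) ≤ β₁ ^ k := pow_le_pow_of_le_one hβ hβ1.le (by omega)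
    rw [← abs_of_nonneg (pow_nonneg hβ k), ← abs_mul, abs_le]
    constructor <;> nlinarith
  -- The late phase leaves weight `0.63` on `g t`, and `S + E ≤ (1/8 + 1/16) g t` by `hSle` and
  -- `hbig`.
  have hmlow : 44 / 100 * g t ≤ m (t + 1) := by
    have h := abs_le.1 (hN (t + 1) le_rfl)
    rw [hm]
    nlinarith
  have hmpos : 0 < m (t + 1) := by linarith
  have hvpos : 0 < v (t + 1) := by
    have := (sqrt_secondMoment_le h0 h1.le hv0 hv t).1
    rw [hv]
    have : 0 < (1 - β₂) * m (t + 1) ^ 2 := by have : 0 < 1 - β₂ := by linarith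
                                              positivity
    positivity
  have hsq : √(v (t + 1)) ≤ √(1 - β₂) * ((A + 2 * S + E) / (1 - κ)) := by
    refine (sqrt_secondMoment_le h0 h1.le hv0 hv (t + 1)).2.trans ?_
    gcongr
    have hterm : ∀ k ∈ Finset.range (t + 1), √β₂ ^ k * |m (t + 1 - k)| ≤ κ ^ k * (A + 2 * S + E) := by
      intro k hk
      have hk' : k ≤ t := by have := Finset.mem_range.1 hk; omega
      have hk1 : β₁ ^ k ≤ 1 := pow_le_one₀ hβ hβ1.le
      have h2 := hN (t + 1 - k) (by omega)
      rw [hκβ, mul_pow, mul_assoc, hm]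
      have hk0 : 0 ≤ β₁ ^ k := by positivity
      refine mul_le_mul_of_nonneg_left ?_ (by positivity)
      calc β₁ ^ k * |expAvg β₁ g (t + 1 - k) + expAvg β₁ n (t + 1 - k)|
          ≤ β₁ ^ k * (|expAvg β₁ g (t + 1 - k)| + |expAvg β₁ n (t + 1 - k)|) := by
            gcongr; exact abs_add_le _ _
        _ ≤ _ := by nlinarith [hAold k hk', abs_nonneg (expAvg β₁ n (t + 1 - k))]
    refine (Finset.sum_le_sum hterm).trans ?_
    rw [← Finset.sum_mul, div_eq_mul_inv, mul_comm]
    have hpos : 0 ≤ A + 2 * S + E := by nlinarith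
    gcongr
    exact sum_le_hasSum _ (fun i _ => by positivity) (hasSum_geometric_of_lt_one hκ hκ1)
  have hsum : A + 2 * S + E ≤ 4 * m (t + 1) := by nlinarith
  have hs1 : 0 < √(1 - β₂) := Real.sqrt_pos.2 (by linarith)
  rw [← mul_div_assoc, le_div_iff₀ (Real.sqrt_pos.2 hvpos)]
  calc (1 - κ) / 4 * √(v (t + 1)) ≤ (1 - κ) / 4 * (√(1 - β₂) * ((A + 2 * S + E) / (1 - κ))) := by
        gcongr
    _ = √(1 - β₂) * ((A + 2 * S + E) / 4) := by field_simp
    _ ≤ _ := by gcongr; linarith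

theorem update_correlation {β₁ β₂ κ b q E : ℝ} {g n m v : ℕ → ℝ} {t : ℕ}
    (hβ : 0 ≤ β₁) (hβ1 : β₁ < 1) (h0 : 0 ≤ β₂) (h1 : β₂ < 1) (hκ : 0 ≤ κ) (hκ1 : κ < 1)
    (hκβ : √β₂ = κ * β₁) (hb : 0 ≤ b) (hE : 0 ≤ E) (hq : q = (1 - β₁) * (1 - κ) / 10)
    (hm : ∀ s, m s = expAvg β₁ g s + expAvg β₁ n s) (hN : ∀ s ≤ t + 1, |expAvg β₁ n s| ≤ E)
    (hv0 : v 0 = 0) (hv : ∀ s, v (s + 1) = β₂ * v s + (1 - β₂) * m (s + 1) ^ 2)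
    (hstep : ∀ s < t, |g s - g (s + 1)| ≤ b + q * |g (s + 1)|)
    (hlate : β₁ ^ (t + 1) ≤ 37 / 100) :
    (1 - κ) / 4 * |g t| - 25 * (b / (1 - β₁) + E)
      ≤ √(1 - β₂) * (g t * (m (t + 1) / √(v (t + 1)))) := by
  have hα : 0 < 1 - β₁ := by linarith
  have hB0 : 0 ≤ b / (1 - β₁) := by positivity
  -- For a small coordinate the update may have the wrong sign, which loses at most `(1 + 1/4) |g
  -- t|`; this is where `25 = 20 · 5/4` comes from.
  by_cases hsmall : |g t| < 20 * (b / (1 - β₁) + E)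
  · have h2 := abs_update_le h0 h1.le hv0 hv t
    have h3 : -(|g t|) ≤ √(1 - β₂) * (g t * (m (t + 1) / √(v (t + 1)))) := by
      refine neg_le_of_abs_le ?_
      rw [abs_mul, abs_mul, abs_of_nonneg (Real.sqrt_nonneg _)]
      nlinarith [abs_nonneg (g t)]
    nlinarith [abs_nonneg (g t)]
  · push Not at hsmall
    rcases lt_trichotomy (g t) 0 with hg | hg | hg
    · have h2 := update_ge_of_pos (g := fun s => -g s) (n := fun s => -n s) (m := fun s => -m s)
        (v := v) hβ hβ1 h0 h1 hκ hκ1 hκβ hb hE hq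
        (fun s => by rw [expAvg_neg, expAvg_neg, hm]; ring)
        (fun s hs => by rw [expAvg_neg, abs_neg]; exact hN s hs) hv0
        (fun s => by rw [hv]; ring)
        (fun s hs => by
          rw [abs_neg, neg_sub_neg, abs_sub_comm]; exact hstep s hs) hlate (by linarith)
        (by rwa [abs_of_neg hg] at hsmall)
      rw [abs_of_neg hg]
      simp only [neg_div, mul_neg] at h2
      nlinarith
    · rw [hg]; simp; positivity
    · have h2 := update_ge_of_pos hβ hβ1 h0 h1 hκ hκ1 hκβ hb hE hq hm hN hv0 hv hstep hlate hg
        (by rwa [abs_of_pos hg] at hsmall)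
      rw [abs_of_pos hg]
      nlinarith

/-! ### Consequences of coordinate-wise smoothness -/

theorem l1Norm_nonneg {d : ℕ} (v : Fin d → ℝ) : 0 ≤ l1Norm v :=
  Finset.sum_nonneg fun _ _ => abs_nonneg _

theorem abs_le_norm_apply {d : ℕ} (v : Fin d → ℝ) (j : Fin d) : |v j| ≤ ‖v‖ := by
  simpa using norm_le_pi_norm v j

theorem euclidean_norm_le_of_abs_le {d : ℕ} {z : EuclideanSpace ℝ (Fin d)} {r : ℝ} (hr0 : 0 ≤ r)
    (hr : ∀ j, |z j| ≤ r) : ‖z‖ ≤ √(d : ℝ) * r := by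
  rw [EuclideanSpace.norm_eq, ← Real.sqrt_sq hr0, ← Real.sqrt_mul (Nat.cast_nonneg d)]
  refine Real.sqrt_le_sqrt ?_
  calc ∑ j, ‖z j‖ ^ 2 ≤ ∑ _j : Fin d, r ^ 2 := by
        gcongr with j; exact hr j
    _ = _ := by simp

namespace CoordSmooth

variable {d : ℕ} {L₀ L₁ : Fin d → ℝ} {F : EuclideanSpace ℝ (Fin d) → ℝ}

/-- The entries of `L₀` and `L₁` carry no sign assumption, so they are replaced here by nonnegative
quantities. -/
theorem abs_gradient_sub_le_norm (h : CoordSmooth L₀ L₁ F) {x y : EuclideanSpace ℝ (Fin d)}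
    (hxy : ‖L₁‖ * ‖x - y‖ ≤ 1) (j : Fin d) :
    |gradient F y j - gradient F x j|
      ≤ (|L₀ j| / √(d : ℝ) + ‖L₁‖ * |gradient F x j|) * ‖y - x‖ := by
  refine (h.smooth x y hxy j).trans ?_
  gcongr
  · exact le_abs_self _
  · exact (le_abs_self _).trans (abs_le_norm_apply L₁ j)

theorem abs_gradient_sub_le (h : CoordSmooth L₀ L₁ F) {x y : EuclideanSpace ℝ (Fin d)} {r : ℝ}
    (hr0 : 0 ≤ r) (hr : ∀ j, |y j - x j| ≤ r) (hL : ‖L₁‖ * (√(d : ℝ) * r) ≤ 1) (j : Fin d) :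
    |gradient F y j - gradient F x j|
      ≤ |L₀ j| * r + ‖L₁‖ * (√(d : ℝ) * r) * |gradient F x j| := by
  have hn : ‖y - x‖ ≤ √(d : ℝ) * r := euclidean_norm_le_of_abs_le hr0 hr
  have hd : 0 < √(d : ℝ) := Real.sqrt_pos.2 (by exact_mod_cast j.pos)
  have hxy : ‖L₁‖ * ‖x - y‖ ≤ 1 := by
    rw [norm_sub_rev]; exact (by gcongr : _ ≤ ‖L₁‖ * (√(d : ℝ) * r)).trans hL
  calc _ ≤ (|L₀ j| / √(d : ℝ) + ‖L₁‖ * |gradient F x j|) * ‖y - x‖ :=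
        h.abs_gradient_sub_le_norm hxy j
    _ ≤ (|L₀ j| / √(d : ℝ) + ‖L₁‖ * |gradient F x j|) * (√(d : ℝ) * r) := by gcongr
    _ = _ := by field_simp

/-- The descent inequality, by the mean value theorem: the gradient at the intermediate point is
compared with that at `x`. The factor `1/2` that integration would give is not needed. -/
theorem sub_le_of_abs_le (h : CoordSmooth L₀ L₁ F) {x y : EuclideanSpace ℝ (Fin d)} {r : ℝ}
    (hr0 : 0 ≤ r) (hr : ∀ j, |y j - x j| ≤ r) (hL : ‖L₁‖ * (√(d : ℝ) * r) ≤ 1) :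
    F y - F x ≤ ∑ j, gradient F x j * (y j - x j)
      + r * (l1Norm L₀ * r + ‖L₁‖ * (√(d : ℝ) * r) * l1Norm (gradient F x).ofLp) := by
  obtain ⟨z, hz, hzF⟩ := domain_mvt (s := Set.univ) (x := x) (y := y)
    (fun z _ => ((h.differentiable z).hasGradientAt.hasFDerivAt).hasFDerivWithinAt)
    convex_univ trivial trivial
  have hzj : ∀ j, |z j - x j| ≤ r := by
    obtain ⟨a, b, ha, hb, hab, rfl⟩ := hz
    intro j
    have : (a • x + b • y) j - x j = b * (y j - x j) := by
      have : a = 1 - b := by linarith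
      simp [this]; ring
    rw [this, abs_mul, abs_of_nonneg hb]
    nlinarith [hr j, abs_nonneg (y j - x j)]
  rw [hzF]
  have hinner : (InnerProductSpace.toDual ℝ (EuclideanSpace ℝ (Fin d))) (gradient F z) (y - x)
      = ∑ j, gradient F z j * (y j - x j) := by
    rw [InnerProductSpace.toDual_apply_apply, PiLp.inner_apply]
    simp [mul_comm]
  rw [hinner, ← sub_le_iff_le_add', ← Finset.sum_sub_distrib]
  calc ∑ j, (gradient F z j * (y j - x j) - gradient F x j * (y j - x j))
      ≤ ∑ j, r * (|L₀ j| * r + ‖L₁‖ * (√(d : ℝ) * r) * |gradient F x j|) := by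
        refine Finset.sum_le_sum fun j _ => ?_
        rw [← sub_mul]
        refine (le_abs_self _).trans ?_
        rw [abs_mul, mul_comm]
        gcongr
        · exact hr j
        · exact h.abs_gradient_sub_le hr0 hzj hL j
    _ = _ := by
        rw [← Finset.mul_sum, Finset.sum_add_distrib, ← Finset.sum_mul, ← Finset.mul_sum]; rfl

/-- An exact sign step of size `r` from `x` lowers `F` by about `r ‖∇F(x)‖₁`, and `F` cannot drop by
more than `Δ`. -/
theorem l1Norm_gradient_le (h : CoordSmooth L₀ L₁ F) (hF : BddBelow (Set.range F))
    {x : EuclideanSpace ℝ (Fin d)} {Δ r : ℝ} (hΔ : F x - (⨅ y, F y) ≤ Δ) (hr0 : 0 < r)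
    (hL : ‖L₁‖ * (√(d : ℝ) * r) ≤ 1 / 10) :
    l1Norm (gradient F x).ofLp ≤ 2 * (Δ / r + r * l1Norm L₀) := by
  set y : EuclideanSpace ℝ (Fin d) :=
    WithLp.toLp 2 fun j => x j - r * (SignType.sign (gradient F x j) : ℝ) with hy
  have hyx : ∀ j, y j - x j = -(r * (SignType.sign (gradient F x j) : ℝ)) := by
    intro j; simp [hy]
  have hs : ∀ a : ℝ, |((SignType.sign a : SignType) : ℝ)| ≤ 1 := by
    intro a
    rcases lt_trichotomy a 0 with ha | ha | ha <;> simp [ha]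
  have hd := h.sub_le_of_abs_le (x := x) (y := y) hr0.le (fun j => by
    rw [hyx, abs_neg, abs_mul, abs_of_pos hr0]
    exact mul_le_of_le_one_right hr0.le (hs _)) (by linarith)
  have hsum : ∑ j, gradient F x j * (y j - x j) = -(r * l1Norm (gradient F x).ofLp) := by
    rw [l1Norm, Finset.mul_sum, ← Finset.sum_neg_distrib]
    refine Finset.sum_congr rfl fun j _ => ?_
    rw [hyx, ← self_mul_sign]; ring
  rw [hsum] at hd
  have hinf : (⨅ z, F z) ≤ F y := ciInf_le hF y
  have hG := l1Norm_nonneg (gradient F x).ofLp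
  have hL0 := l1Norm_nonneg L₀
  have hmain : r * l1Norm (gradient F x).ofLp ≤ 2 * (Δ + r ^ 2 * l1Norm L₀) := by
    nlinarith [mul_le_mul_of_nonneg_right hL (mul_nonneg hr0.le hG),
      mul_nonneg (sq_nonneg r) hL0, mul_nonneg hr0.le hG]
  have : 2 * (Δ / r + r * l1Norm L₀) = 2 * (Δ + r ^ 2 * l1Norm L₀) / r := by
    field_simp
  rw [this, le_div_iff₀ hr0]
  linarith

end CoordSmooth

/-! ### Deterministic analysis of a trajectory -/

section Run

variable {d : ℕ} {Ξ : Type*} (f : EuclideanSpace ℝ (Fin d) → Ξ → ℝ)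
  (F : EuclideanSpace ℝ (Fin d) → ℝ) (β₁ β₂ η : ℝ) (x₁ : EuclideanSpace ℝ (Fin d)) (ξ : ℕ → Ξ)

/-- Coordinate `j` of the gradient at the point reached after `t` iterations. -/
noncomputable def runGrad (j : Fin d) (t : ℕ) : ℝ := gradient F (signRun f β₁ β₂ η x₁ ξ t).x j

/-- Coordinate `j` of the gradient noise at the point reached after `t` iterations. -/
noncomputable def runNoise (j : Fin d) (t : ℕ) : ℝ :=
  stochGrad f (signRun f β₁ β₂ η x₁ ξ t).x (ξ (t + 1)) j
    - gradient F (signRun f β₁ β₂ η x₁ ξ t).x j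

theorem signRun_m (j : Fin d) (t : ℕ) :
    (signRun f β₁ β₂ η x₁ ξ t).m j = expAvg β₁ (runGrad f F β₁ β₂ η x₁ ξ j) t
      + expAvg β₁ (runNoise f F β₁ β₂ η x₁ ξ j) t := by
  rw [← expAvg_add]
  induction t with
  | zero => simp [signRun, expAvg]
  | succ t ih =>
    simp only [signRun, signStep, expAvg, runGrad, runNoise] at ih ⊢
    rw [ih]; ring

theorem signRun_v (j : Fin d) (t : ℕ) :
    (signRun f β₁ β₂ η x₁ ξ (t + 1)).v j = β₂ * (signRun f β₁ β₂ η x₁ ξ t).v j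
      + (1 - β₂) * (signRun f β₁ β₂ η x₁ ξ (t + 1)).m j ^ 2 := rfl

theorem signRun_x (j : Fin d) (t : ℕ) :
    (signRun f β₁ β₂ η x₁ ξ (t + 1)).x j = (signRun f β₁ β₂ η x₁ ξ t).x j
      - η * ((signRun f β₁ β₂ η x₁ ξ (t + 1)).m j
        / √((signRun f β₁ β₂ η x₁ ξ (t + 1)).v j)) := rfl

variable {f F β₁ β₂ η x₁ ξ}

theorem abs_signRun_x_sub_le (h0 : 0 ≤ β₂) (h1 : β₂ < 1) (hη : 0 ≤ η) (j : Fin d) (t : ℕ) :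
    |(signRun f β₁ β₂ η x₁ ξ (t + 1)).x j - (signRun f β₁ β₂ η x₁ ξ t).x j| ≤ η / √(1 - β₂) := by
  have h := abs_update_le (m := fun t => (signRun f β₁ β₂ η x₁ ξ t).m j)
    (v := fun t => (signRun f β₁ β₂ η x₁ ξ t).v j) h0 h1.le (by simp [signRun])
    (fun s => signRun_v f β₁ β₂ η x₁ ξ j s) t
  have hs : 0 < √(1 - β₂) := Real.sqrt_pos.2 (by linarith)
  rw [signRun_x, sub_sub_cancel_left, abs_neg, abs_mul, abs_of_nonneg hη, le_div_iff₀ hs]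
  nlinarith

theorem card_early_le {α : ℝ} (hα : 0 < α) (T : ℕ) :
    (((Finset.range T).filter fun t : ℕ => α * (t + 1) < 1).card : ℝ) ≤ 1 / α := by
  have hsub : ((Finset.range T).filter fun t : ℕ => α * (t + 1) < 1)
      ⊆ Finset.range ⌊1 / α⌋₊ := by
    intro t ht
    have := (Finset.mem_filter.1 ht).2
    refine Finset.mem_range.2 (Nat.lt_of_succ_le (Nat.le_floor ?_))
    rw [le_div_iff₀ hα]; push_cast; linarith
  have := Finset.card_le_card hsub
  rw [Finset.card_range] at this
  exact (Nat.cast_le.2 this).trans (Nat.floor_le (by positivity))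

theorem one_sub_pow_le_of_late {α : ℝ} (hα1 : α ≤ 1) {n : ℕ} (h : 1 ≤ α * n) :
    (1 - α) ^ n ≤ 37 / 100 := by
  have h1 : (1 - α) ^ n ≤ Real.exp (-α) ^ n :=
    pow_le_pow_left₀ (by linarith) (Real.one_sub_le_exp_neg α) n
  rw [← Real.exp_nat_mul] at h1
  have h2 : Real.exp (n * -α) ≤ Real.exp (-1) := Real.exp_le_exp.2 (by linarith)
  have h3 : Real.exp (-1) ≤ 37 / 100 := by
    rw [Real.exp_neg, inv_le_comm₀ (Real.exp_pos _) (by norm_num)]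
    have := Real.exp_one_gt_d9
    norm_num at this ⊢; linarith
  linarith

theorem one_add_pow_le_of_early {q : ℝ} (hq : 0 ≤ q) {n : ℕ} (h : q * n ≤ 1 / 10) :
    (1 + q) ^ n ≤ 112 / 100 := by
  have h1 : (1 + q) ^ n ≤ Real.exp q ^ n :=
    pow_le_pow_left₀ (by linarith) (by linarith [Real.add_one_le_exp q]) n
  rw [← Real.exp_nat_mul] at h1
  have h2 : Real.exp (n * q) ≤ Real.exp (1 / 10) := Real.exp_le_exp.2 (by linarith)
  have h3 : Real.exp (1 / 10) ≤ 112 / 100 := by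
    rw [← neg_neg (1 / 10 : ℝ), Real.exp_neg, inv_le_comm₀ (Real.exp_pos _) (by norm_num)]
    have := Real.add_one_le_exp (-(1 / 10) : ℝ)
    norm_num at this ⊢; linarith
  linarith

variable {L₀ L₁ E : Fin d → ℝ} {κ : ℝ}

/-- Both directions are needed: the bound relative to the earlier gradient controls early growth,
the one relative to the later gradient controls the averaging window. -/
theorem abs_runGrad_step_le (h : CoordSmooth L₀ L₁ F) (h0 : 0 ≤ β₂) (h1 : β₂ < 1) (hη : 0 ≤ η)
    (hL : ‖L₁‖ * (√(d : ℝ) * (η / √(1 - β₂))) ≤ 1) (j : Fin d) (t : ℕ) :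
    |runGrad f F β₁ β₂ η x₁ ξ j (t + 1) - runGrad f F β₁ β₂ η x₁ ξ j t|
        ≤ |L₀ j| * (η / √(1 - β₂))
          + ‖L₁‖ * (√(d : ℝ) * (η / √(1 - β₂))) * |runGrad f F β₁ β₂ η x₁ ξ j t| ∧
    |runGrad f F β₁ β₂ η x₁ ξ j t - runGrad f F β₁ β₂ η x₁ ξ j (t + 1)|
        ≤ |L₀ j| * (η / √(1 - β₂))
          + ‖L₁‖ * (√(d : ℝ) * (η / √(1 - β₂))) * |runGrad f F β₁ β₂ η x₁ ξ j (t + 1)| :=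
  ⟨h.abs_gradient_sub_le (by positivity) (fun j => abs_signRun_x_sub_le h0 h1 hη j t) hL j,
    h.abs_gradient_sub_le (by positivity)
      (fun j => by rw [abs_sub_comm]; exact abs_signRun_x_sub_le h0 h1 hη j t) hL j⟩

theorem signRun_early_l1Norm_le {α : ℝ} (h : CoordSmooth L₀ L₁ F) (h0 : 0 ≤ β₂) (h1 : β₂ < 1)
    (hη : 0 ≤ η) (hα : 0 < α) (hα1 : α ≤ 1)
    (hL : ‖L₁‖ * (√(d : ℝ) * (η / √(1 - β₂))) ≤ α / 10) {t : ℕ} (ht : α * t ≤ 1) :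
    l1Norm (gradient F (signRun f β₁ β₂ η x₁ ξ t).x).ofLp
      ≤ 112 / 100 * (l1Norm (gradient F x₁).ofLp + l1Norm L₀ * (η / √(1 - β₂)) / α) := by
  set r := η / √(1 - β₂) with hr
  have hr0 : 0 ≤ r := by positivity
  set q := ‖L₁‖ * (√(d : ℝ) * r) with hq
  have hq0 : 0 ≤ q := by positivity
  have hqt : q * t ≤ 1 / 10 := by
    have : (0 : ℝ) ≤ t := Nat.cast_nonneg t
    nlinarith
  have hpow := one_add_pow_le_of_early hq0 hqt
  have htα : (t : ℝ) ≤ 1 / α := by rw [le_div_iff₀ hα]; linarith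
  have hcoord : ∀ j, |gradient F (signRun f β₁ β₂ η x₁ ξ t).x j|
      ≤ 112 / 100 * (|gradient F x₁ j| + |L₀ j| * r / α) := by
    intro j
    have hd := abs_sub_le_of_relative_steps (h := runGrad f F β₁ β₂ η x₁ ξ j) (n := t)
      (b := |L₀ j| * r) (q := q) (by positivity) hq0
      (fun i _ => (abs_runGrad_step_le h h0 h1 hη (by linarith) j i).1) t le_rfl
    have hr00 : runGrad f F β₁ β₂ η x₁ ξ j 0 = gradient F x₁ j := rfl
    rw [hr00] at hd
    have habs : |runGrad f F β₁ β₂ η x₁ ξ j t|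
        ≤ |gradient F x₁ j| + |runGrad f F β₁ β₂ η x₁ ξ j t - gradient F x₁ j| := by
      have := abs_add_le (gradient F x₁ j) (runGrad f F β₁ β₂ η x₁ ξ j t - gradient F x₁ j)
      simpa using this
    have hb : (t : ℝ) * (1 + q) ^ t * (|L₀ j| * r + q * |gradient F x₁ j|)
        ≤ 112 / 100 * (|L₀ j| * r / α) + 112 / 1000 * |gradient F x₁ j| := by
      have e : (t : ℝ) * (1 + q) ^ t * (|L₀ j| * r + q * |gradient F x₁ j|)
          = (1 + q) ^ t * (t * (|L₀ j| * r)) + (1 + q) ^ t * ((q * t) * |gradient F x₁ j|) := by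
        ring
      have e1 : (1 + q) ^ t * (t * (|L₀ j| * r)) ≤ 112 / 100 * (1 / α * (|L₀ j| * r)) := by
        gcongr
      have e2 : (1 + q) ^ t * ((q * t) * |gradient F x₁ j|)
          ≤ 112 / 100 * (1 / 10 * |gradient F x₁ j|) := by gcongr
      rw [e]
      refine (add_le_add e1 e2).trans_eq ?_
      ring
    change |runGrad f F β₁ β₂ η x₁ ξ j t| ≤ _
    linarith [abs_nonneg (gradient F x₁ j)]
  calc _ ≤ ∑ j, 112 / 100 * (|gradient F x₁ j| + |L₀ j| * r / α) :=
        Finset.sum_le_sum fun j _ => hcoord j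
    _ = _ := by
        rw [← Finset.mul_sum, Finset.sum_add_distrib, ← Finset.sum_div, ← Finset.sum_mul]; rfl

theorem signRun_sub_le_early {α : ℝ} (h : CoordSmooth L₀ L₁ F) (h0 : 0 ≤ β₂) (h1 : β₂ < 1)
    (hη : 0 ≤ η) (hα : 0 < α) (hα1 : α ≤ 1)
    (hL : ‖L₁‖ * (√(d : ℝ) * (η / √(1 - β₂))) ≤ α / 10) (t : ℕ) :
    F (signRun f β₁ β₂ η x₁ ξ (t + 1)).x - F (signRun f β₁ β₂ η x₁ ξ t).x
      ≤ η / √(1 - β₂) * (11 / 10 * l1Norm (gradient F (signRun f β₁ β₂ η x₁ ξ t).x).ofLp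
        + l1Norm L₀ * (η / √(1 - β₂)) / α) := by
  have hstep := fun j => abs_signRun_x_sub_le (f := f) (β₁ := β₁) (x₁ := x₁) (ξ := ξ) h0 h1 hη j t
  have hd := h.sub_le_of_abs_le (by positivity) hstep (by linarith)
  set r := η / √(1 - β₂) with hr
  have hr0 : 0 ≤ r := by positivity
  set G := l1Norm (gradient F (signRun f β₁ β₂ η x₁ ξ t).x).ofLp with hG
  have hG0 : 0 ≤ G := l1Norm_nonneg _
  have hsum : ∑ j, gradient F (signRun f β₁ β₂ η x₁ ξ t).x j
      * ((signRun f β₁ β₂ η x₁ ξ (t + 1)).x j - (signRun f β₁ β₂ η x₁ ξ t).x j) ≤ r * G := by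
    rw [hG, l1Norm, Finset.mul_sum]
    refine Finset.sum_le_sum fun j _ => (le_abs_self _).trans ?_
    rw [abs_mul, mul_comm]
    exact mul_le_mul_of_nonneg_right (hstep j) (abs_nonneg _)
  have hL0 := l1Norm_nonneg L₀
  have hB : l1Norm L₀ * r ≤ l1Norm L₀ * r / α := by
    rw [le_div_iff₀ hα]; exact mul_le_of_le_one_right (by positivity) hα1
  have hq : ‖L₁‖ * (√(d : ℝ) * r) * G ≤ 1 / 10 * G := by gcongr; linarith
  nlinarith [mul_le_mul_of_nonneg_left (add_le_add hB hq) hr0]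

/-- `update_correlation` is summed over coordinates and inserted in the descent inequality. The
second-order remainder turns `25` into `26` and `1/4` into `1/4 - 1/10 = 15/100`. -/
theorem signRun_sub_le_late (h : CoordSmooth L₀ L₁ F) (hβ : 0 ≤ β₁) (hβ1 : β₁ < 1) (h0 : 0 ≤ β₂)
    (h1 : β₂ < 1) (hκ : 0 ≤ κ) (hκ1 : κ < 1) (hκβ : √β₂ = κ * β₁) (hη : 0 ≤ η)
    (hL : ‖L₁‖ * (√(d : ℝ) * (η / √(1 - β₂))) ≤ (1 - β₁) * (1 - κ) / 10)
    (hE : ∀ j, 0 ≤ E j) {t : ℕ}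
    (hN : ∀ j, ∀ s ≤ t + 1, |expAvg β₁ (runNoise f F β₁ β₂ η x₁ ξ j) s| ≤ E j)
    (hlate : 1 ≤ (1 - β₁) * (t + 1)) :
    F (signRun f β₁ β₂ η x₁ ξ (t + 1)).x - F (signRun f β₁ β₂ η x₁ ξ t).x
      ≤ η / √(1 - β₂) * (26 * (l1Norm L₀ * (η / √(1 - β₂)) / (1 - β₁) + l1Norm E)
        - 15 / 100 * (1 - κ) * l1Norm (gradient F (signRun f β₁ β₂ η x₁ ξ t).x).ofLp) := by
  have hα : 0 < 1 - β₁ := by linarith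
  have hρ : 0 < 1 - κ := by linarith
  have hq1 : (1 - β₁) * (1 - κ) / 10 ≤ (1 - κ) / 10 := by nlinarith
  have hs : 0 < √(1 - β₂) := Real.sqrt_pos.2 (by linarith)
  have hstep := fun j => abs_signRun_x_sub_le (f := f) (β₁ := β₁) (x₁ := x₁) (ξ := ξ) h0 h1 hη j t
  have hd := h.sub_le_of_abs_le (by positivity) hstep (by linarith)
  have hdrift := fun j s => abs_runGrad_step_le (f := f) (β₁ := β₁) (x₁ := x₁) (ξ := ξ)
    h h0 h1 hη (by linarith) j s
  set r := η / √(1 - β₂) with hr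
  have hr0 : 0 ≤ r := by positivity
  set G := l1Norm (gradient F (signRun f β₁ β₂ η x₁ ξ t).x).ofLp with hG
  have hG0 : 0 ≤ G := l1Norm_nonneg _
  have hcoord : ∀ j, gradient F (signRun f β₁ β₂ η x₁ ξ t).x j
      * ((signRun f β₁ β₂ η x₁ ξ (t + 1)).x j - (signRun f β₁ β₂ η x₁ ξ t).x j)
      ≤ r * (25 * (|L₀ j| * r / (1 - β₁) + |E j|)
        - (1 - κ) / 4 * |gradient F (signRun f β₁ β₂ η x₁ ξ t).x j|) := by
    intro j
    have hc := update_correlation (g := runGrad f F β₁ β₂ η x₁ ξ j)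
      (n := runNoise f F β₁ β₂ η x₁ ξ j) (m := fun t => (signRun f β₁ β₂ η x₁ ξ t).m j)
      (v := fun t => (signRun f β₁ β₂ η x₁ ξ t).v j) (t := t) (b := |L₀ j| * r) hβ hβ1 h0 h1 hκ
      hκ1 hκβ (by positivity) (hE j) rfl (fun s => signRun_m f F β₁ β₂ η x₁ ξ j s) (hN j)
      (by simp [signRun]) (fun s => signRun_v f β₁ β₂ η x₁ ξ j s)
      (fun s _ => (hdrift j s).2.trans (by gcongr))
      (by
        have := one_sub_pow_le_of_late (α := 1 - β₁) (n := t + 1) (by linarith)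
          (by push_cast; exact hlate)
        rwa [sub_sub_cancel] at this)
    rw [signRun_x, sub_sub_cancel_left, abs_of_nonneg (hE j)]
    have hηr : η = r * √(1 - β₂) := by rw [hr]; field_simp
    have := mul_le_mul_of_nonneg_left hc hr0
    simp only [runGrad] at this
    calc _ = -(r * (√(1 - β₂) * (gradient F (signRun f β₁ β₂ η x₁ ξ t).x j
            * ((signRun f β₁ β₂ η x₁ ξ (t + 1)).m j
              / √((signRun f β₁ β₂ η x₁ ξ (t + 1)).v j))))) := by
          rw [← mul_assoc r, ← hηr]; ring
      _ ≤ _ := by linarith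
  have hsum : ∑ j, gradient F (signRun f β₁ β₂ η x₁ ξ t).x j
      * ((signRun f β₁ β₂ η x₁ ξ (t + 1)).x j - (signRun f β₁ β₂ η x₁ ξ t).x j)
      ≤ r * (25 * (l1Norm L₀ * r / (1 - β₁) + l1Norm E) - (1 - κ) / 4 * G) := by
    refine (Finset.sum_le_sum fun j _ => hcoord j).trans_eq ?_
    rw [← Finset.mul_sum, Finset.sum_sub_distrib, ← Finset.mul_sum, ← Finset.mul_sum,
      Finset.sum_add_distrib, ← Finset.sum_div, ← Finset.sum_mul]
    rfl
  have hL0 := l1Norm_nonneg L₀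
  have hEn := l1Norm_nonneg E
  have hB : l1Norm L₀ * r ≤ l1Norm L₀ * r / (1 - β₁) := by
    rw [le_div_iff₀ hα]; exact mul_le_of_le_one_right (by positivity) (by linarith)
  have hq : ‖L₁‖ * (√(d : ℝ) * r) * G ≤ (1 - κ) / 10 * G := by gcongr; linarith
  have := mul_le_mul_of_nonneg_left (add_le_add hB hq) hr0
  have := mul_nonneg hr0 hEn
  nlinarith

theorem signRun_min_bound (h : CoordSmooth L₀ L₁ F) (hF : BddBelow (Set.range F)) {Δ : ℝ}
    (hΔ : F x₁ - (⨅ y, F y) ≤ Δ) (hβ : 0 ≤ β₁) (hβ1 : β₁ < 1) (h0 : 0 ≤ β₂)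
    (h1 : β₂ < 1) (hκ : 0 ≤ κ) (hκ1 : κ < 1) (hκβ : √β₂ = κ * β₁) (hη : 0 ≤ η)
    (hL : ‖L₁‖ * (√(d : ℝ) * (η / √(1 - β₂))) ≤ (1 - β₁) * (1 - κ) / 10)
    (hE : ∀ j, 0 ≤ E j) {T : ℕ}
    (hN : ∀ j, ∀ s ≤ T, |expAvg β₁ (runNoise f F β₁ β₂ η x₁ ξ j) s| ≤ E j) {ℓ : ℝ}
    (hℓ : ∀ t < T, ℓ ≤ l1Norm (gradient F (signRun f β₁ β₂ η x₁ ξ t).x).ofLp) :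
    η / √(1 - β₂) * (T * (15 / 100 * (1 - κ) * ℓ))
      ≤ Δ + η / √(1 - β₂) * (T * (26 * (l1Norm L₀ * (η / √(1 - β₂)) / (1 - β₁) + l1Norm E))
        + 3 / 2 * l1Norm (gradient F x₁).ofLp / (1 - β₁)) := by
  have hα : 0 < 1 - β₁ := by linarith
  have hρ : 0 < 1 - κ := by linarith
  have hq1 : (1 - β₁) * (1 - κ) / 10 ≤ (1 - β₁) / 10 := by nlinarith
  have hearly := fun t => signRun_sub_le_early (f := f) (β₁ := β₁) (x₁ := x₁) (ξ := ξ) h h0 h1 hη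
    hα (by linarith) (hL.trans hq1) t
  have hlate := fun t (ht : t < T) => signRun_sub_le_late (f := f) (x₁ := x₁) (ξ := ξ) h hβ hβ1 h0
    h1 hκ hκ1 hκβ hη hL hE (t := t) (fun j s hs => hN j s (by omega))
  have hdrift := fun t => signRun_early_l1Norm_le (f := f) (β₁ := β₁) (x₁ := x₁) (ξ := ξ) h h0 h1 hη
    hα (by linarith) (hL.trans hq1) (t := t)
  set r := η / √(1 - β₂) with hr
  have hr0 : 0 ≤ r := by positivity
  set B := l1Norm L₀ * r / (1 - β₁) with hB
  have hB0 : 0 ≤ B := by have := l1Norm_nonneg L₀; positivity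
  have hE0 := l1Norm_nonneg E
  set G₀ := l1Norm (gradient F x₁).ofLp with hG₀
  have hG₀0 : 0 ≤ G₀ := l1Norm_nonneg _
  -- Early steps are given the late bound plus a surcharge, so that only the surcharge is counted
  -- over early times. Its size: `1.1 · 1.12 + 0.15 · 1.12 = 1.4 ≤ 3/2`.
  have hstep : ∀ t ∈ Finset.range T,
      F (signRun f β₁ β₂ η x₁ ξ (t + 1)).x - F (signRun f β₁ β₂ η x₁ ξ t).x
        ≤ r * (26 * (B + l1Norm E) - 15 / 100 * (1 - κ) * ℓ)
          + if (1 - β₁) * (t + 1) < 1 then r * (3 / 2 * G₀) else 0 := by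
    intro t ht
    have ht := Finset.mem_range.1 ht
    have hl := hℓ t ht
    have hG0 := l1Norm_nonneg (gradient F (signRun f β₁ β₂ η x₁ ξ t).x).ofLp
    have hl' : 15 / 100 * (1 - κ) * ℓ
        ≤ 15 / 100 * (1 - κ) * l1Norm (gradient F (signRun f β₁ β₂ η x₁ ξ t).x).ofLp := by
      gcongr
    split_ifs with hc
    · have hd := hdrift t (by linarith)
      refine (hearly t).trans ?_
      rw [← mul_add]
      refine mul_le_mul_of_nonneg_left ?_ hr0
      nlinarith
    · refine (hlate t ht (not_lt.1 hc)).trans ?_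
      rw [add_zero]
      refine mul_le_mul_of_nonneg_left ?_ hr0
      linarith
  have htel := Finset.sum_range_sub (fun t => F (signRun f β₁ β₂ η x₁ ξ t).x) T
  have hsum := Finset.sum_le_sum hstep
  rw [htel, Finset.sum_add_distrib, Finset.sum_const, Finset.card_range, nsmul_eq_mul,
    ← Finset.sum_filter, Finset.sum_const, nsmul_eq_mul] at hsum
  have hcard := mul_le_mul_of_nonneg_right (card_early_le hα T)
    (show 0 ≤ r * (3 / 2 * G₀) by positivity)
  have hinf : (⨅ y, F y) ≤ F (signRun f β₁ β₂ η x₁ ξ T).x := ciInf_le hF _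
  have hx0 : (signRun f β₁ β₂ η x₁ ξ 0).x = x₁ := rfl
  rw [hx0] at hsum
  have e : 1 / (1 - β₁) * (r * (3 / 2 * G₀)) = r * (3 / 2 * G₀ / (1 - β₁)) := by
    field_simp
  rw [e] at hcard
  nlinarith

end Run

/-! ### Concentration of the averaged noise -/

section Concentration

variable {d : ℕ} {Ξ : Type*} [MeasurableSpace Ξ] {f : EuclideanSpace ℝ (Fin d) → Ξ → ℝ}
  {F : EuclideanSpace ℝ (Fin d) → ℝ} {L₀ L₁ σ : Fin d → ℝ} {𝒟 : Measure Ξ}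

theorem CoordSmooth.measurable_gradient (h : CoordSmooth L₀ L₁ F) : Measurable (gradient F) :=
  h.differentiable_gradient.continuous.measurable

theorem measurable_signRun {Ω : Type*} [MeasurableSpace Ω] (β₁ β₂ η : ℝ)
    (x₁ : EuclideanSpace ℝ (Fin d)) {ξ : ℕ → Ω → Ξ}
    (hg : Measurable fun p : EuclideanSpace ℝ (Fin d) × Ξ => stochGrad f p.1 p.2) {k : ℕ}
    (hξ : ∀ i ≤ k, Measurable (ξ i)) :
    Measurable (fun ω => (signRun f β₁ β₂ η x₁ (fun s => ξ s ω) k).x) ∧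
      (∀ j, Measurable fun ω => (signRun f β₁ β₂ η x₁ (fun s => ξ s ω) k).m j) ∧
      ∀ j, Measurable fun ω => (signRun f β₁ β₂ η x₁ (fun s => ξ s ω) k).v j := by
  induction k with
  | zero => exact ⟨measurable_const, fun _ => measurable_const, fun _ => measurable_const⟩
  | succ k ih =>
    obtain ⟨hx, hm, hv⟩ := ih fun i hi => hξ i (by omega)
    have hgk : Measurable fun ω => stochGrad f (signRun f β₁ β₂ η x₁ (fun s => ξ s ω) k).x
        (ξ (k + 1) ω) := hg.comp (hx.prodMk (hξ (k + 1) le_rfl))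
    have hgj : ∀ j, Measurable fun ω =>
        stochGrad f (signRun f β₁ β₂ η x₁ (fun s => ξ s ω) k).x (ξ (k + 1) ω) j :=
      fun j => (EuclideanSpace.proj (𝕜 := ℝ) j).measurable.comp hgk
    have hxj : ∀ j, Measurable fun ω => (signRun f β₁ β₂ η x₁ (fun s => ξ s ω) k).x j :=
      fun j => (EuclideanSpace.proj (𝕜 := ℝ) j).measurable.comp hx
    have hm' : ∀ j, Measurable fun ω =>
        (signRun f β₁ β₂ η x₁ (fun s => ξ s ω) (k + 1)).m j := fun j => by
      simp only [signRun, signStep]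
      exact ((hm j).const_mul _).add ((hgj j).const_mul _)
    have hv' : ∀ j, Measurable fun ω =>
        (signRun f β₁ β₂ η x₁ (fun s => ξ s ω) (k + 1)).v j := fun j => by
      simp only [signRun_v]
      exact ((hv j).const_mul _).add (((hm' j).pow_const 2).const_mul _)
    refine ⟨?_, hm', hv'⟩
    exact (WithLp.measurable_toLp 2 (Fin d → ℝ)).comp
      (measurable_pi_lambda _ fun j => (hxj j).sub (((hm' j).div (hv' j).sqrt).const_mul _))

theorem measurable_expAvg_runNoise {Ω : Type*} [MeasurableSpace Ω] (β₁ β₂ η : ℝ)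
    (x₁ : EuclideanSpace ℝ (Fin d)) {ξ : ℕ → Ω → Ξ} (hF : Measurable (gradient F))
    (hg : Measurable fun p : EuclideanSpace ℝ (Fin d) × Ξ => stochGrad f p.1 p.2) (j : Fin d)
    {k : ℕ} (hξ : ∀ i ≤ k, Measurable (ξ i)) :
    Measurable fun ω => expAvg β₁ (runNoise f F β₁ β₂ η x₁ (fun s => ξ s ω) j) k := by
  induction k with
  | zero => exact measurable_const
  | succ k ih =>
    have hx := (measurable_signRun (f := f) β₁ β₂ η x₁ hg (k := k)
      fun i hi => hξ i (by omega)).1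
    simp only [expAvg, runNoise]
    exact ((ih fun i hi => hξ i (by omega)).const_mul _).add
      ((((EuclideanSpace.proj (𝕜 := ℝ) j).measurable.comp
          (hg.comp (hx.prodMk (hξ (k + 1) le_rfl)))).sub
        ((EuclideanSpace.proj (𝕜 := ℝ) j).measurable.comp (hF.comp hx))).const_mul _)

theorem lintegral_exp_noise_le [IsProbabilityMeasure 𝒟] (hf : IsStochasticObjective 𝒟 f F)
    (hσ : BoundedNoise 𝒟 f F σ) (x : EuclideanSpace ℝ (Fin d)) (j : Fin d) (c : ℝ) :
    ∫⁻ z, ENNReal.ofReal (Real.exp (c * (stochGrad f x z j - gradient F x j))) ∂𝒟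
      ≤ ENNReal.ofReal (Real.exp (c ^ 2 * σ j ^ 2 / 2)) := by
  have hmeas : Measurable fun z => stochGrad f x z j - gradient F x j :=
    ((EuclideanSpace.proj (𝕜 := ℝ) j).measurable.comp
      (hf.measurable_grad.comp (measurable_const.prodMk measurable_id))).sub_const _
  have hint : Integrable (fun z => stochGrad f x z j) 𝒟 :=
    (EuclideanSpace.proj (𝕜 := ℝ) j).integrable_comp (hf.integrable_grad x)
  have hmean : ∫ z, (stochGrad f x z j - gradient F x j) ∂𝒟 = 0 := by
    rw [integral_sub hint (integrable_const _)]
    have h := (EuclideanSpace.proj (𝕜 := ℝ) j).integral_comp_comm (hf.integrable_grad x)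
    rw [hf.unbiased x] at h
    have h' : ∫ z, stochGrad f x z j ∂𝒟 = gradient F x j := h
    rw [h']; simp
  have hsub := hasSubgaussianMGF_of_mem_Icc_of_integral_eq_zero (a := -σ j) (b := σ j)
    hmeas.aemeasurable
    (by filter_upwards [(hσ j).2 x] with z hz using abs_le.1 hz) hmean
  rw [← ofReal_integral_eq_lintegral_ofReal (hsub.integrable_exp_mul c)
    (Filter.Eventually.of_forall fun _ => (Real.exp_pos _).le)]
  refine ENNReal.ofReal_le_ofReal ((hsub.mgf_le c).trans_eq ?_)
  congr 1
  have hσj := (hσ j).1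
  have : ((‖σ j - -σ j‖₊ : ℝ) / 2) = σ j := by
    rw [coe_nnnorm, Real.norm_of_nonneg (by linarith)]; ring
  push_cast
  rw [coe_nnnorm] at this
  rw [this]; ring

variable {Ω : Type*} [MeasurableSpace Ω] {P : Measure Ω} {ξ : ℕ → Ω → Ξ}

/-- Quantifying `hZ` over all σ-algebras says that `Z` depends on the first samples only; it is then
used for the σ-algebra they generate. -/
theorem indepFun_history {Y : Type*} [mY : MeasurableSpace Y] (hξ : ∀ t, Measurable (ξ t))
    (hind : iIndepFun ξ P) (k : ℕ) {Z : Ω → Y}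
    (hZ : ∀ mΩ' : MeasurableSpace Ω, (∀ i ≤ k, Measurable[mΩ'] (ξ i)) → Measurable[mΩ'] Z) :
    IndepFun Z (ξ (k + 1)) P := by
  have h := indep_iSup_of_disjoint (fun i => (hξ i).comap_le) hind.iIndep
    (S := Set.Iic k) (T := {k + 1}) (by simp)
  rw [IndepFun_iff_Indep]
  refine indep_of_indep_of_le_right (indep_of_indep_of_le_left h ?_) ?_
  · refine (hZ _ fun i hi => ?_).comap_le
    exact measurable_iff_comap_le.2 (le_iSup₂_of_le i hi le_rfl)
  · exact le_iSup₂_of_le (k + 1) (Set.mem_singleton _) le_rfl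

variable [IsProbabilityMeasure P]

/-- The fresh sample is independent of the past average and the current point, so by Fubini
Hoeffding's lemma applies with the point frozen. The proxy `(1 - β₁) σ_j²` is preserved because `β₁²
(1 - β₁) + (1 - β₁)² ≤ 1 - β₁`. -/
theorem lintegral_exp_expAvg_runNoise_le [IsProbabilityMeasure 𝒟] {β₁ : ℝ} (β₂ η : ℝ)
    (x₁ : EuclideanSpace ℝ (Fin d)) (hξ : ∀ t, Measurable (ξ t)) (hlaw : ∀ t, P.map (ξ t) = 𝒟)
    (hind : iIndepFun ξ P) (hf : IsStochasticObjective 𝒟 f F) (hF : Measurable (gradient F))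
    (hσ : BoundedNoise 𝒟 f F σ) (hβ : 0 ≤ β₁) (hβ1 : β₁ ≤ 1) (j : Fin d) (k : ℕ) (c : ℝ) :
    ∫⁻ ω, ENNReal.ofReal (Real.exp
        (c * expAvg β₁ (runNoise f F β₁ β₂ η x₁ (fun s => ξ s ω) j) k)) ∂P
      ≤ ENNReal.ofReal (Real.exp (c ^ 2 * ((1 - β₁) * σ j ^ 2) / 2)) := by
  induction k generalizing c with
  | zero =>
    simp only [expAvg, mul_zero, Real.exp_zero, lintegral_const, measure_univ, mul_one]
    refine ENNReal.ofReal_le_ofReal (Real.one_le_exp ?_)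
    have : 0 ≤ 1 - β₁ := by linarith
    positivity
  | succ k ih =>
    set Z : Ω → ℝ × EuclideanSpace ℝ (Fin d) := fun ω =>
      (expAvg β₁ (runNoise f F β₁ β₂ η x₁ (fun s => ξ s ω) j) k,
        (signRun f β₁ β₂ η x₁ (fun s => ξ s ω) k).x) with hZ
    have hZmeas : ∀ mΩ' : MeasurableSpace Ω, (∀ i ≤ k, Measurable[mΩ'] (ξ i)) →
        Measurable[mΩ'] Z := fun mΩ' h =>
      (measurable_expAvg_runNoise β₁ β₂ η x₁ hF hf.measurable_grad j h).prodMk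
        (measurable_signRun β₁ β₂ η x₁ hf.measurable_grad h).1
    have hZm : Measurable Z := hZmeas _ fun i _ => hξ i
    have hprod := (indepFun_history hξ hind k hZmeas).map_prod_eq_prod_map_map
      hZm.aemeasurable (hξ (k + 1)).aemeasurable
    rw [hlaw] at hprod
    set Φ : (ℝ × EuclideanSpace ℝ (Fin d)) × Ξ → ENNReal := fun p =>
      ENNReal.ofReal (Real.exp (c * β₁ * p.1.1))
        * ENNReal.ofReal (Real.exp
          (c * (1 - β₁) * (stochGrad f p.1.2 p.2 j - gradient F p.1.2 j))) with hΦ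
    have hΦm : Measurable Φ := by
      have h1 : Measurable fun p : (ℝ × EuclideanSpace ℝ (Fin d)) × Ξ =>
          stochGrad f p.1.2 p.2 j :=
        (EuclideanSpace.proj (𝕜 := ℝ) j).measurable.comp
          (hf.measurable_grad.comp ((measurable_snd.comp measurable_fst).prodMk measurable_snd))
      have h2 : Measurable fun p : (ℝ × EuclideanSpace ℝ (Fin d)) × Ξ => gradient F p.1.2 j :=
        (EuclideanSpace.proj (𝕜 := ℝ) j).measurable.comp
          (hF.comp (measurable_snd.comp measurable_fst))
      have h3 : Measurable fun p : (ℝ × EuclideanSpace ℝ (Fin d)) × Ξ => p.1.1 :=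
        measurable_fst.comp measurable_fst
      exact (h3.const_mul _).exp.ennreal_ofReal.mul
        ((h1.sub h2).const_mul _).exp.ennreal_ofReal
    calc _ = ∫⁻ ω, Φ (Z ω, ξ (k + 1) ω) ∂P := by
          refine lintegral_congr fun ω => ?_
          simp only [hΦ, hZ]
          rw [← ENNReal.ofReal_mul (Real.exp_pos _).le, ← Real.exp_add]
          simp only [expAvg, runNoise]
          congr 2; ring
      _ = ∫⁻ p, Φ p ∂((P.map Z).prod 𝒟) := by
          rw [← hprod, lintegral_map hΦm (hZm.prodMk (hξ (k + 1)))]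
      _ = ∫⁻ y, ∫⁻ z, Φ (y, z) ∂𝒟 ∂(P.map Z) := lintegral_prod _ hΦm.aemeasurable
      _ ≤ ∫⁻ y, ENNReal.ofReal (Real.exp (c * β₁ * y.1))
            * ENNReal.ofReal (Real.exp ((c * (1 - β₁)) ^ 2 * σ j ^ 2 / 2)) ∂(P.map Z) := by
          refine lintegral_mono fun y => ?_
          simp only [hΦ]
          rw [lintegral_const_mul' _ _ ENNReal.ofReal_ne_top]
          gcongr
          exact lintegral_exp_noise_le hf hσ y.2 j _
      _ = (∫⁻ ω, ENNReal.ofReal (Real.exp (c * β₁ * (Z ω).1)) ∂P)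
            * ENNReal.ofReal (Real.exp ((c * (1 - β₁)) ^ 2 * σ j ^ 2 / 2)) := by
          rw [lintegral_mul_const' _ _ ENNReal.ofReal_ne_top,
            lintegral_map (measurable_fst.const_mul _).exp.ennreal_ofReal hZm]
      _ ≤ ENNReal.ofReal (Real.exp ((c * β₁) ^ 2 * ((1 - β₁) * σ j ^ 2) / 2))
            * ENNReal.ofReal (Real.exp ((c * (1 - β₁)) ^ 2 * σ j ^ 2 / 2)) := by
          gcongr; exact ih (c * β₁)
      _ ≤ _ := by
          rw [← ENNReal.ofReal_mul (Real.exp_pos _).le, ← Real.exp_add]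
          refine ENNReal.ofReal_le_ofReal (Real.exp_le_exp.2 ?_)
          have h1 : β₁ ^ 2 * (1 - β₁) + (1 - β₁) ^ 2 ≤ 1 - β₁ := by
            nlinarith [mul_nonneg (mul_nonneg hβ (sub_nonneg.2 hβ1)) (sub_nonneg.2 hβ1)]
          have h2 := mul_le_mul_of_nonneg_left h1
            (mul_nonneg (sq_nonneg c) (sq_nonneg (σ j)))
          linarith

theorem measure_abs_expAvg_runNoise_gt_le [IsProbabilityMeasure 𝒟] {β₁ : ℝ} (β₂ η : ℝ)
    (x₁ : EuclideanSpace ℝ (Fin d)) (hξ : ∀ t, Measurable (ξ t)) (hlaw : ∀ t, P.map (ξ t) = 𝒟)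
    (hind : iIndepFun ξ P) (hf : IsStochasticObjective 𝒟 f F) (hF : Measurable (gradient F))
    (hσ : BoundedNoise 𝒟 f F σ) (hβ : 0 ≤ β₁) (hβ1 : β₁ < 1) (j : Fin d) (k : ℕ) {s : ℝ}
    (hs : 0 ≤ s) :
    P {ω | σ j * √(2 * (1 - β₁) * s)
        < |expAvg β₁ (runNoise f F β₁ β₂ η x₁ (fun s => ξ s ω) j) k|}
      ≤ ENNReal.ofReal (2 * Real.exp (-s)) := by
  have hσj := (hσ j).1
  have hα : 0 < 1 - β₁ := by linarith
  set N : Ω → ℝ := fun ω => expAvg β₁ (runNoise f F β₁ β₂ η x₁ (fun s => ξ s ω) j) k with hN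
  have hNm : Measurable N :=
    measurable_expAvg_runNoise β₁ β₂ η x₁ hF hf.measurable_grad j fun i _ => hξ i
  set e := σ j * √(2 * (1 - β₁) * s) with he
  -- The optimal Chernoff parameter: `c e = 2s` while the log moment bound equals `s`, leaving `exp
  -- (-s)`.
  set c := √(2 * (1 - β₁) * s) / ((1 - β₁) * σ j) with hc
  have hsq : √(2 * (1 - β₁) * s) ^ 2 = 2 * (1 - β₁) * s := Real.sq_sqrt (by positivity)
  have hce : c * e = 2 * s := by
    have : c * e = √(2 * (1 - β₁) * s) ^ 2 / (1 - β₁) := by rw [hc, he]; field_simp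
    rw [this, hsq]; field_simp
  have hcc : c ^ 2 * ((1 - β₁) * σ j ^ 2) / 2 = s := by
    rw [hc, div_pow, hsq]; field_simp
  have hc0 : 0 ≤ c := by positivity
  have hside : ∀ u : ℝ, u ^ 2 = 1 → P {ω | e ≤ u * N ω} ≤ ENNReal.ofReal (Real.exp (-s)) := by
    intro u hu
    have hmark := mul_meas_ge_le_lintegral (μ := P)
      (((hNm.const_mul (u * c)).exp).ennreal_ofReal) (ENNReal.ofReal (Real.exp (2 * s)))
    have hmgf := lintegral_exp_expAvg_runNoise_le β₂ η x₁ hξ hlaw hind hf hF hσ hβ hβ1.le j k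
      (u * c)
    rw [mul_pow, hu, one_mul, hcc] at hmgf
    have hle := hmark.trans hmgf
    have hsubset : {ω | e ≤ u * N ω} ⊆ {ω | ENNReal.ofReal (Real.exp (2 * s))
        ≤ ENNReal.ofReal (Real.exp (u * c * N ω))} := by
      intro ω hω
      refine ENNReal.ofReal_le_ofReal (Real.exp_le_exp.2 ?_)
      have := mul_le_mul_of_nonneg_left (show e ≤ u * N ω from hω) hc0
      rw [hce] at this
      linarith
    refine (measure_mono hsubset).trans ?_
    have hpos : ENNReal.ofReal (Real.exp (2 * s)) ≠ 0 := by
      simpa using Real.exp_pos _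
    rw [mul_comm, ← ENNReal.le_div_iff_mul_le (Or.inl hpos) (Or.inl ENNReal.ofReal_ne_top),
      ← ENNReal.ofReal_div_of_pos (Real.exp_pos _), ← Real.exp_sub] at hle
    rwa [show s - 2 * s = -s by ring] at hle
  have hsub : {ω | e < |N ω|} ⊆ {ω | e ≤ 1 * N ω} ∪ {ω | e ≤ (-1) * N ω} := by
    intro ω hω
    rcases lt_abs.1 (show e < |N ω| from hω) with h | h
    · exact Or.inl (show e ≤ 1 * N ω by linarith)
    · exact Or.inr (show e ≤ (-1) * N ω by linarith)
  refine (measure_mono hsub).trans ((measure_union_le _ _).trans ?_)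
  refine (add_le_add (hside 1 (by norm_num)) (hside (-1) (by norm_num))).trans_eq ?_
  rw [← ENNReal.ofReal_add (Real.exp_pos _).le (Real.exp_pos _).le, two_mul]

theorem ofReal_one_sub_le_measure {δ : ℝ} {S B : Set Ω} (hB : P B ≤ ENNReal.ofReal δ)
    (hSB : Bᶜ ⊆ S) (hδ : 0 ≤ δ) : ENNReal.ofReal (1 - δ) ≤ P S := by
  have h1 : (1 : ENNReal) ≤ P B + P S := by
    rw [← measure_univ (μ := P), ← Set.union_compl_self B]
    exact (measure_union_le _ _).trans (by gcongr)
  rw [ENNReal.ofReal_sub _ hδ, ENNReal.ofReal_one, tsub_le_iff_left]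
  exact h1.trans (by gcongr)

theorem measure_exists_abs_expAvg_runNoise_gt_le [IsProbabilityMeasure 𝒟] {β₁ : ℝ} (β₂ η : ℝ)
    (x₁ : EuclideanSpace ℝ (Fin d)) (hξ : ∀ t, Measurable (ξ t)) (hlaw : ∀ t, P.map (ξ t) = 𝒟)
    (hind : iIndepFun ξ P) (hf : IsStochasticObjective 𝒟 f F) (hF : Measurable (gradient F))
    (hσ : BoundedNoise 𝒟 f F σ) (hβ : 0 ≤ β₁) (hβ1 : β₁ < 1) {T : ℕ} {δ : ℝ} (hδ : 0 < δ)
    (hδT : δ ≤ 2 * (d * T)) :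
    P {ω | ∃ j, ∃ k ∈ Finset.Icc 1 T, σ j * √(2 * (1 - β₁) * Real.log (2 * (d * T) / δ))
        < |expAvg β₁ (runNoise f F β₁ β₂ η x₁ (fun s => ξ s ω) j) k|} ≤ ENNReal.ofReal δ := by
  have hdT : (0 : ℝ) < d * T := by linarith
  have hlog : 0 ≤ Real.log (2 * (d * T) / δ) :=
    Real.log_nonneg (by rw [le_div_iff₀ hδ]; linarith)
  have hexp : 2 * Real.exp (-Real.log (2 * (d * T) / δ)) = δ / (d * T) := by
    rw [Real.exp_neg, Real.exp_log (by positivity)]; field_simp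
  have hset : {ω | ∃ j, ∃ k ∈ Finset.Icc 1 T,
        σ j * √(2 * (1 - β₁) * Real.log (2 * (d * T) / δ))
          < |expAvg β₁ (runNoise f F β₁ β₂ η x₁ (fun s => ξ s ω) j) k|}
      = ⋃ j ∈ (Finset.univ : Finset (Fin d)), ⋃ k ∈ Finset.Icc 1 T,
        {ω | σ j * √(2 * (1 - β₁) * Real.log (2 * (d * T) / δ))
          < |expAvg β₁ (runNoise f F β₁ β₂ η x₁ (fun s => ξ s ω) j) k|} := by
    ext ω; simp only [Set.mem_iUnion, Finset.mem_univ, exists_prop, true_and]; rfl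
  rw [hset]
  calc _ ≤ ∑ _j : Fin d, ∑ _k ∈ Finset.Icc 1 T, ENNReal.ofReal (δ / (d * T)) := by
        refine (measure_biUnion_finset_le _ _).trans (Finset.sum_le_sum fun j _ =>
          (measure_biUnion_finset_le _ _).trans (Finset.sum_le_sum fun k _ => ?_))
        rw [← hexp]
        exact measure_abs_expAvg_runNoise_gt_le β₂ η x₁ hξ hlaw hind hf hF hσ hβ hβ1 j k hlog
    _ = ENNReal.ofReal δ := by
        simp only [Finset.sum_const, Finset.card_univ, Fintype.card_fin, Nat.card_Icc,
          Nat.add_sub_cancel]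
        rw [← ENNReal.ofReal_nsmul, ← ENNReal.ofReal_nsmul, nsmul_eq_mul, nsmul_eq_mul]
        congr 1
        have h1 : (d : ℝ) ≠ 0 := fun h => by simp [h] at hdT
        have h2 : (T : ℝ) ≠ 0 := fun h => by simp [h] at hdT
        field_simp

end Concentration

/-! ### Arithmetic of the parameter choice -/

theorem expNegDiv_nonneg (a b : ℝ) : 0 ≤ expNegDiv a b := by
  unfold expNegDiv; split_ifs <;> positivity

theorem rpow_one_fourth {x : ℝ} (hx : 0 ≤ x) : x ^ (1 / 4 : ℝ) = √√x := by
  rw [Real.sqrt_eq_rpow, Real.sqrt_eq_rpow, ← Real.rpow_mul hx]; norm_num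

/-- The step size and momentum parameters of the theorem, with positive `Δ`. -/
structure SignParams (T : ℕ) (L S Δ α η : ℝ) : Prop where
  T_pos : (0 : ℝ) < T
  L_pos : 0 < L
  S_pos : 0 < S
  Δ_pos : 0 < Δ
  α_eq : α = min (√L * √Δ / (S * √(T : ℝ))) 1
  η_eq : η = √(Δ * α) / (√L * √(T : ℝ))

namespace SignParams

variable {T : ℕ} {L S Δ α η : ℝ}

theorem α_pos (h : SignParams T L S Δ α η) : 0 < α := by
  have := h.T_pos; have := h.L_pos; have := h.S_pos; have := h.Δ_pos
  rw [h.α_eq]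
  exact lt_min (by positivity) one_pos

theorem α_le_one (h : SignParams T L S Δ α η) : α ≤ 1 := by
  rw [h.α_eq]; exact min_le_right _ _

theorem η_pos (h : SignParams T L S Δ α η) : 0 < η := by
  have := h.T_pos; have := h.L_pos; have := h.Δ_pos; have := h.α_pos
  rw [h.η_eq]
  positivity

theorem η_sq (h : SignParams T L S Δ α η) : η ^ 2 * (L * T) = Δ * α := by
  have h1 := h.T_pos; have h2 := h.L_pos; have := h.Δ_pos; have := h.α_pos
  rw [h.η_eq, div_pow, mul_pow, Real.sq_sqrt h1.le, Real.sq_sqrt h2.le,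
    Real.sq_sqrt (by positivity)]
  field_simp

theorem α_eq_of_lt_one (h : SignParams T L S Δ α η) (hα : α < 1) :
    α = √L * √Δ / (S * √(T : ℝ)) := by
  have h1 := h.α_eq
  rcases min_choice (√L * √Δ / (S * √(T : ℝ))) 1 with h2 | h2
  · rw [h1, h2]
  · rw [h2] at h1; linarith

theorem sqrt_α_mul (h : SignParams T L S Δ α η) (hα : α < 1) :
    √α * S = L ^ (1 / 4 : ℝ) * Δ ^ (1 / 4 : ℝ) * S ^ (1 / 2 : ℝ) / (T : ℝ) ^ (1 / 4 : ℝ) := by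
  have h1 := h.T_pos; have h2 := h.L_pos; have h3 := h.S_pos
  rw [h.α_eq_of_lt_one hα, rpow_one_fourth h2.le, rpow_one_fourth h.Δ_pos.le,
    rpow_one_fourth h1.le,
    ← Real.sqrt_eq_rpow, Real.sqrt_div (by positivity), Real.sqrt_mul (by positivity),
    Real.sqrt_mul h3.le]
  nth_rewrite 2 [← Real.mul_self_sqrt h3.le]
  field_simp

/-- The choice of `α` balances the two errors: drift over the memory of the average, and averaged
noise. -/
theorem ratio_eq_of_lt_one (h : SignParams T L S Δ α η) (hα : α < 1) :
    η * L / α = √α * S := by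
  have h1 := h.T_pos; have h2 := h.L_pos; have h3 := h.S_pos; have h4 := h.Δ_pos
  have h5 := h.α_pos
  have hS : α * (S * √(T : ℝ)) = √L * √Δ := by
    have := h.α_eq_of_lt_one hα
    rw [eq_div_iff (by positivity)] at this
    exact this
  rw [h.η_eq, Real.sqrt_mul h4.le]
  rw [div_eq_iff h5.ne', div_mul_eq_mul_div, div_eq_iff (by positivity)]
  calc √Δ * √α * L = √L * √Δ * √α * √L := by
        nth_rewrite 1 [← Real.mul_self_sqrt h2.le]; ring
    _ = _ := by rw [← hS]; ring

theorem ratio_eq_of_eq_one (h : SignParams T L S Δ α η) (hα : α = 1) :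
    η * L / α = √(L * Δ) / √(T : ℝ) := by
  have h1 := h.T_pos; have h2 := h.L_pos
  rw [h.η_eq, hα, mul_one, div_one, Real.sqrt_mul h2.le]
  nth_rewrite 2 [← Real.mul_self_sqrt h2.le]
  field_simp

theorem S_le_of_eq_one (h : SignParams T L S Δ α η) (hα : α = 1) :
    S ≤ √(L * Δ) / √(T : ℝ) := by
  have h1 := h.T_pos; have h2 := h.L_pos; have h3 := h.S_pos
  have h4 := h.α_eq
  rw [hα] at h4
  have h5 := min_eq_right_iff.1 h4.symm
  rw [le_div_iff₀ (by positivity), one_mul] at h5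
  rwa [Real.sqrt_mul h2.le, le_div_iff₀ (by positivity)]

theorem Δ_eq (h : SignParams T L S Δ α η) : Δ = η * T * (η * L / α) := by
  have h5 := h.α_pos
  have := h.η_sq
  field_simp
  linarith

/-- After squaring, the claim is `100 W ≤ α T`. The first entry of the maximum gives it when `α =
1`, the second when `α < 1`, where `α² S² T = L Δ`. -/
theorem drift_le (h : SignParams T L S Δ α η) {d : ℕ} {ℓ β₂ ρ : ℝ} (hβ₂ : β₂ < 1)
    (hρ : 0 < ρ) (hT : max (100 * d * Δ * ℓ ^ 2 / ((1 - β₂) * ρ ^ 2 * L))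
      (10000 * d ^ 2 * Δ * S ^ 2 * ℓ ^ 4 / ((1 - β₂) ^ 2 * ρ ^ 4 * L ^ 3)) ≤ (T : ℝ)) :
    ℓ * (√(d : ℝ) * (η / √(1 - β₂))) ≤ α * ρ / 10 := by
  have h1 := h.T_pos; have h2 := h.L_pos; have h3 := h.S_pos; have h4 := h.Δ_pos
  have h5 := h.α_pos
  have hβ : 0 < 1 - β₂ := by linarith
  set W := d * Δ * ℓ ^ 2 / ((1 - β₂) * ρ ^ 2 * L) with hW
  have hW0 : 0 ≤ W := by positivity
  have hT1 : 100 * W ≤ T := by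
    refine le_trans (le_of_eq ?_) ((le_max_left _ _).trans hT)
    rw [hW]; ring
  have hWα : 100 * W ≤ α * T := by
    rcases h.α_le_one.lt_or_eq with hα | hα
    · have hT2 : 10000 * W ^ 2 * S ^ 2 / (L * Δ) ≤ T := by
        refine le_trans (le_of_eq ?_) ((le_max_right _ _).trans hT)
        rw [hW]; field_simp
      rw [div_le_iff₀ (by positivity)] at hT2
      have hsq : α ^ 2 * (S ^ 2 * T) = L * Δ := by
        rw [h.α_eq_of_lt_one hα, div_pow, mul_pow, mul_pow, Real.sq_sqrt h1.le,
          Real.sq_sqrt h2.le, Real.sq_sqrt h4.le]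
        field_simp
      refine (le_abs_self _).trans (abs_le_of_sq_le_sq ?_ (by positivity))
      have : (100 * W) ^ 2 * S ^ 2 ≤ (α * T) ^ 2 * S ^ 2 := by
        rw [← hsq] at hT2; linarith
      exact le_of_mul_le_mul_right this (by positivity)
    · rw [hα, one_mul]; exact hT1
  refine (le_abs_self _).trans (abs_le_of_sq_le_sq ?_ (by positivity))
  have e : (ℓ * (√(d : ℝ) * (η / √(1 - β₂)))) ^ 2 = W * ρ ^ 2 * α / T := by
    have hη : η ^ 2 = Δ * α / (L * T) := by
      rw [eq_div_iff (by positivity)]; exact h.η_sq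
    rw [mul_pow, mul_pow, div_pow, Real.sq_sqrt (Nat.cast_nonneg d), Real.sq_sqrt hβ.le, hη, hW]
    field_simp
  rw [e, div_le_iff₀ h1]
  have := mul_le_mul_of_nonneg_right hWα (show 0 ≤ α * ρ ^ 2 / 100 by positivity)
  linarith

end SignParams

/-! ### The bound on the good event -/

section Main

variable {d : ℕ} {Ξ : Type*} {f : EuclideanSpace ℝ (Fin d) → Ξ → ℝ}
  {F : EuclideanSpace ℝ (Fin d) → ℝ} {β₁ β₂ η κ : ℝ} {x₁ : EuclideanSpace ℝ (Fin d)} {ξ : ℕ → Ξ}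
  {L₀ L₁ E : Fin d → ℝ}

theorem signRun_min_le {T : ℕ} {S Δ α : ℝ} (hp : SignParams T (l1Norm L₀) S Δ α η)
    (h : CoordSmooth L₀ L₁ F) (hF : BddBelow (Set.range F))
    (hΔ : F x₁ - (⨅ y, F y) ≤ Δ) (hβα : β₁ = 1 - α) (h0 : 0 ≤ β₂)
    (h1 : β₂ < 1) (hκ : 0 ≤ κ) (hκ1 : κ < 1) (hκβ : √β₂ = κ * β₁)
    (hL : ‖L₁‖ * (√(d : ℝ) * (η / √(1 - β₂))) ≤ α * (1 - κ) / 10)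
    (hE : ∀ j, 0 ≤ E j)
    (hN : ∀ j, ∀ s ≤ T, |expAvg β₁ (runNoise f F β₁ β₂ η x₁ ξ j) s| ≤ E j) {ℓ : ℝ}
    (hℓ : ∀ t < T, ℓ ≤ l1Norm (gradient F (signRun f β₁ β₂ η x₁ ξ t).x).ofLp) :
    (1 - κ) * ℓ ≤ 220 * (η * l1Norm L₀ / α / √(1 - β₂) + l1Norm E) := by
  have hT := hp.T_pos
  have hα := hp.α_pos
  have hα1 := hp.α_le_one
  have hη := hp.η_pos
  have hL0 := hp.L_pos
  have hE0 := l1Norm_nonneg E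
  have hs : 0 < √(1 - β₂) := Real.sqrt_pos.2 (by linarith)
  have hs1 : √(1 - β₂) ≤ 1 := Real.sqrt_le_one.2 (by linarith)
  have hαβ : 1 - β₁ = α := by rw [hβα]; ring
  have hΔeq := hp.Δ_eq
  set R := η * l1Norm L₀ / α with hR
  have hR0 : 0 < R := by positivity
  have hRs : R ≤ R / √(1 - β₂) := by
    rw [le_div_iff₀ hs]; exact mul_le_of_le_one_right hR0.le hs1
  -- A sign step of size `η / α`, the distance scale of one memory length, is admissible and makes
  -- both terms multiples of `R`.
  have hG : l1Norm (gradient F x₁).ofLp ≤ 2 * (α * T * R + R) := by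
    have hLα : ‖L₁‖ * (√(d : ℝ) * (η / α)) ≤ 1 / 10 := by
      have e1 : ‖L₁‖ * (√(d : ℝ) * η) ≤ ‖L₁‖ * (√(d : ℝ) * (η / √(1 - β₂))) := by
        gcongr
        rw [le_div_iff₀ hs]; exact mul_le_of_le_one_right hη.le hs1
      have e2 : ‖L₁‖ * (√(d : ℝ) * (η / α)) = ‖L₁‖ * (√(d : ℝ) * η) / α := by ring
      rw [e2, div_le_iff₀ hα]
      nlinarith
    refine (h.l1Norm_gradient_le hF hΔ (by positivity) hLα).trans_eq ?_
    congr 2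
    · rw [hΔeq]; field_simp
    · rw [hR]; ring
  rcases le_or_gt 1 (α * T) with hαT | hαT
  · have hmin := signRun_min_bound (T := T) (ξ := ξ) (f := f) h hF hΔ (β₁ := β₁) (by linarith)
      (by linarith) h0 h1 hκ hκ1 hκβ hη.le (by rwa [hαβ]) hE hN hℓ
    rw [hαβ] at hmin
    set r := η / √(1 - β₂) with hr
    have hr0 : 0 < r := by positivity
    have hB : l1Norm L₀ * r / α = R / √(1 - β₂) := by rw [hr, hR]; field_simp
    have hΔr : Δ ≤ r * (T * (R / √(1 - β₂))) := by
      have : Δ = r * (T * (R * √(1 - β₂))) := by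
        rw [hΔeq, hr]; field_simp
      rw [this]
      gcongr
      exact (mul_le_of_le_one_right hR0.le hs1).trans hRs
    have hGα : 3 / 2 * l1Norm (gradient F x₁).ofLp / α ≤ T * (6 * (R / √(1 - β₂))) := by
      rw [div_le_iff₀ hα]
      nlinarith [mul_le_mul_of_nonneg_right hαT hR0.le,
        mul_le_mul_of_nonneg_left hRs (mul_pos hα hT).le]
    rw [hB] at hmin
    -- Here `33 = 1 + 26 + 6`, from `Δ`, the per-step error and the early phase; then `33 / 0.15 =
    -- 220`. When `α T < 1`, the first iterate alone suffices by `hG`.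
    have hmul : r * (T * (15 / 100 * (1 - κ) * ℓ))
        ≤ r * (T * (33 * (R / √(1 - β₂) + l1Norm E))) := by
      nlinarith [mul_le_mul_of_nonneg_left hGα hr0.le, mul_nonneg hr0.le (mul_nonneg hT.le hE0)]
    have := le_of_mul_le_mul_left (le_of_mul_le_mul_left hmul hr0) hT
    linarith
  · have hT' : 0 < T := by exact_mod_cast hT
    have hl : ℓ ≤ l1Norm (gradient F x₁).ofLp := hℓ 0 hT'
    have hl2 : ℓ ≤ 4 * (R / √(1 - β₂)) := by nlinarith
    have hR' : 0 < R / √(1 - β₂) := by positivity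
    rcases le_or_gt 0 ℓ with hp | hp <;> nlinarith

end Main

namespace SignParams

variable {T d : ℕ} {S Δ α η : ℝ} {L₀ : Fin d → ℝ}

theorem rate_bound {σ : Fin d → ℝ} (h : SignParams T (l1Norm L₀) (l1Norm σ) Δ α η)
    {β₂ ρ δ ℓ : ℝ} (hβ₂0 : 0 ≤ β₂) (hβ₂ : β₂ < 1) (hα : α = 1 → β₂ = 0) (hρ : 0 < ρ)
    (hlog : 2 ≤ d * T / δ)
    (hℓ : ρ * ℓ ≤ 220 * (η * l1Norm L₀ / α / √(1 - β₂)
      + l1Norm σ * √(2 * α * Real.log (2 * (d * T) / δ)))) :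
    ℓ ≤ 2000 * (√(Real.log (d * T / δ)) * l1Norm L₀ ^ (1 / 4 : ℝ) * Δ ^ (1 / 4 : ℝ)
          * l1Norm σ ^ (1 / 2 : ℝ) / (ρ * √(1 - β₂) * (T : ℝ) ^ (1 / 4 : ℝ))
        + Real.log (d * T / δ) * √(l1Norm L₀ * Δ) / (ρ * √(T : ℝ))) := by
  have hT := h.T_pos
  have hL := h.L_pos
  have hS := h.S_pos
  have hΔ := h.Δ_pos
  have hα0 := h.α_pos
  have hs : 0 < √(1 - β₂) := Real.sqrt_pos.2 (by linarith)
  have hs1 : √(1 - β₂) ≤ 1 := Real.sqrt_le_one.2 (by linarith)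
  set k := Real.log (d * T / δ) with hk
  have hk0 : 1 / 2 ≤ k := by
    have h2 : Real.log 2 ≤ k := Real.log_le_log (by norm_num) hlog
    have := Real.log_two_gt_d9
    linarith
  -- The factor `2` from the two-sided tail is absorbed because `d T / δ ≥ 2`.
  have hk2 : Real.log (2 * (d * T) / δ) ≤ 2 * k := by
    have hpos : (0 : ℝ) < d * T / δ := by linarith
    rw [two_mul k, hk, ← Real.log_mul hpos.ne' hpos.ne', mul_div_assoc]
    exact Real.log_le_log (by linarith) (by nlinarith)
  have hsk : 1 ≤ 2 * √k := by
    have : √(1 / 4 : ℝ) ≤ √k := Real.sqrt_le_sqrt (by linarith)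
    rw [show (1 / 4 : ℝ) = (1 / 2) ^ 2 by norm_num, Real.sqrt_sq (by norm_num)] at this
    linarith
  have hkk : √k * √k = k := Real.mul_self_sqrt (by linarith)
  have hnoise : √(2 * α * Real.log (2 * (d * T) / δ)) ≤ 2 * (√α * √k) := by
    rw [← Real.sqrt_mul hα0.le]
    refine Real.sqrt_le_iff.2 ⟨by positivity, ?_⟩
    rw [mul_pow, Real.sq_sqrt (by positivity)]
    nlinarith
  have hnoise' := mul_le_mul_of_nonneg_left hnoise hS.le
  have hterm : 0 ≤ k * √(l1Norm L₀ * Δ) / (ρ * √(T : ℝ)) := by positivity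
  rcases h.α_le_one.lt_or_eq with hα1 | hα1
  · have hp := h.sqrt_α_mul hα1
    rw [h.ratio_eq_of_lt_one hα1] at hℓ
    have hp0 : 0 < √α * l1Norm σ := by positivity
    have e : √k * l1Norm L₀ ^ (1 / 4 : ℝ) * Δ ^ (1 / 4 : ℝ) * l1Norm σ ^ (1 / 2 : ℝ)
        / (ρ * √(1 - β₂) * (T : ℝ) ^ (1 / 4 : ℝ))
        = √k * (√α * l1Norm σ) / (ρ * √(1 - β₂)) := by
      rw [hp]; field_simp
    rw [e]
    set p := √α * l1Norm σ with hpdef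
    have h1 : p / √(1 - β₂) ≤ 2 * (√k * p / √(1 - β₂)) := by
      have : 0 < p / √(1 - β₂) := by positivity
      have e2 : √k * p / √(1 - β₂) = √k * (p / √(1 - β₂)) := by ring
      rw [e2]; nlinarith
    have h2 : l1Norm σ * (2 * (√α * √k)) ≤ 2 * (√k * p / √(1 - β₂)) := by
      have : √k * p ≤ √k * p / √(1 - β₂) := by
        rw [le_div_iff₀ hs]; exact mul_le_of_le_one_right (by positivity) hs1
      rw [hpdef] at this ⊢
      linarith
    have h3 : ρ * ℓ ≤ 880 * (√k * p / √(1 - β₂)) := by linarith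
    have h4 : √k * p / (ρ * √(1 - β₂)) = √k * p / √(1 - β₂) / ρ := by field_simp
    have h5 : ℓ ≤ 880 * (√k * p / √(1 - β₂)) / ρ := by rw [le_div_iff₀ hρ]; linarith
    have h6 : 0 ≤ √k * p / √(1 - β₂) / ρ := by positivity
    rw [h4]
    rw [mul_div_assoc] at h5
    linarith
  · have hw := h.S_le_of_eq_one hα1
    rw [h.ratio_eq_of_eq_one hα1, hα hα1] at hℓ
    rw [hα1, Real.sqrt_one, one_mul] at hnoise'
    simp only [hα1, sub_zero, Real.sqrt_one, div_one] at hℓ hnoise'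
    set w := √(l1Norm L₀ * Δ) / √(T : ℝ) with hwdef
    have hw0 : 0 < w := by positivity
    have hfirst : 0 ≤ √k * l1Norm L₀ ^ (1 / 4 : ℝ) * Δ ^ (1 / 4 : ℝ) * l1Norm σ ^ (1 / 2 : ℝ)
        / (ρ * √(1 - β₂) * (T : ℝ) ^ (1 / 4 : ℝ)) := by positivity
    have hskk : √k ≤ 2 * k := by nlinarith [Real.sqrt_nonneg k]
    have h1 : l1Norm σ * (2 * √k) ≤ w * (4 * k) :=
      mul_le_mul hw (by linarith) (by positivity) hw0.le
    have h2 : w ≤ 2 * (w * k) := by nlinarith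
    have h3 : ρ * ℓ ≤ 1320 * (k * w) := by linarith
    have h4 : ℓ ≤ 1320 * (k * w) / ρ := by rw [le_div_iff₀ hρ]; linarith
    have h5 : k * √(l1Norm L₀ * Δ) / (ρ * √(T : ℝ)) = k * w / ρ := by rw [hwdef]; field_simp
    rw [mul_div_assoc] at h4
    have h6 : 0 ≤ k * w / ρ := by positivity
    rw [h5]
    linarith

end SignParams

/-! ### Assembly of the high-probability guarantees -/

theorem gradient_eq_zero_of_eq_iInf {d : ℕ} {F : EuclideanSpace ℝ (Fin d) → ℝ}
    {x : EuclideanSpace ℝ (Fin d)} (hF : BddBelow (Set.range F)) (hx : F x ≤ ⨅ y, F y) :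
    gradient F x = 0 := by
  have hmin : IsLocalMin F x := Filter.Eventually.of_forall fun y => hx.trans (ciInf_le hF y)
  simp [gradient, hmin.fderiv_eq_zero]

theorem signIter_min_le_with_high_probability {d : ℕ} {Ω Ξ : Type*} [MeasurableSpace Ω]
    [MeasurableSpace Ξ] {P : Measure Ω} [IsProbabilityMeasure P] {𝒟 : Measure Ξ}
    [IsProbabilityMeasure 𝒟] {ξ : ℕ → Ω → Ξ} {f : EuclideanSpace ℝ (Fin d) → Ξ → ℝ}
    {F : EuclideanSpace ℝ (Fin d) → ℝ} {L₀ L₁ σ : Fin d → ℝ} {x₁ : EuclideanSpace ℝ (Fin d)}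
    {T : ℕ} (hT : 1 ≤ T) (hT2 : 2 ≤ T) {Δ α β₁ β₂ ρ η δ : ℝ}
    (hξ : ∀ t, Measurable (ξ t)) (hlaw : ∀ t, P.map (ξ t) = 𝒟) (hind : iIndepFun ξ P)
    (hf : IsStochasticObjective 𝒟 f F) (hF : BddBelow (Set.range F)) (hL₀ : 0 < l1Norm L₀)
    (h : CoordSmooth L₀ L₁ F) (hσ : BoundedNoise 𝒟 f F σ) (hΔ : F x₁ - (⨅ x, F x) ≤ Δ)
    (hΔ0 : 0 < Δ) (hα : α = min (√(l1Norm L₀) * √Δ / (l1Norm σ * √(T : ℝ))) 1)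
    (hβ₁ : β₁ = 1 - α) (hβ₂0 : 0 ≤ β₂) (hβ₂ : β₂ = 0 ∨ √β₂ < β₁) (hρ : ρ = 1 - √β₂ / β₁)
    (hη : η = √(Δ * α) / (√(l1Norm L₀) * √(T : ℝ)))
    (hTle : max (100 * d * Δ * ‖L₁‖ ^ 2 / ((1 - β₂) * ρ ^ 2 * l1Norm L₀))
          (10000 * d ^ 2 * Δ * l1Norm σ ^ 2 * ‖L₁‖ ^ 4
            / ((1 - β₂) ^ 2 * ρ ^ 4 * l1Norm L₀ ^ 3)) ≤ (T : ℝ))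
    (hδ : 0 < δ) (hδ1 : δ < 1) :
    ENNReal.ofReal (1 - δ) ≤ P {ω |
      (Finset.Icc 1 T).inf' (Finset.nonempty_Icc.mpr hT)
        (fun t => l1Norm (gradient F (signIter f β₁ β₂ η x₁ (fun s => ξ s ω) t)).ofLp)
      ≤ 2000 * (√(Real.log (d * T / δ)) * l1Norm L₀ ^ (1 / 4 : ℝ) * Δ ^ (1 / 4 : ℝ)
            * l1Norm σ ^ (1 / 2 : ℝ) / (ρ * √(1 - β₂) * (T : ℝ) ^ (1 / 4 : ℝ))
          + Real.log (d * T / δ) * √(l1Norm L₀ * Δ) / (ρ * √(T : ℝ)))} := by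
  have hd : 1 ≤ d := by
    rcases Nat.eq_zero_or_pos d with rfl | hd
    · simp [l1Norm] at hL₀
    · exact hd
  have hS : 0 < l1Norm σ :=
    Finset.sum_pos (fun j _ => abs_pos.2 (hσ j).1.ne') ⟨⟨0, hd⟩, Finset.mem_univ _⟩
  have hp : SignParams T (l1Norm L₀) (l1Norm σ) Δ α η :=
    ⟨by exact_mod_cast hT, hL₀, hS, hΔ0, hα, hη⟩
  have hα0 := hp.α_pos
  have hα1 := hp.α_le_one
  have hβ₁1 : β₁ < 1 := by linarith
  have hβ₁0 : 0 ≤ β₁ := by linarith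
  have hβ₂1 : β₂ < 1 := by
    rcases hβ₂ with h2 | h2
    · linarith
    · exact by simpa using (Real.sqrt_lt_sqrt_iff hβ₂0).1 ((h2.trans hβ₁1).trans_eq Real.sqrt_one.symm)
  have hκβ : √β₂ = √β₂ / β₁ * β₁ := by
    rcases hβ₂ with h2 | h2
    · simp [h2]
    · rw [div_mul_cancel₀]
      exact ((Real.sqrt_nonneg _).trans_lt h2).ne'
  have hκ1 : √β₂ / β₁ < 1 := by
    rcases hβ₂ with h2 | h2
    · simp [h2]
    · exact (div_lt_one ((Real.sqrt_nonneg _).trans_lt h2)).2 h2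
  have hκ0 : 0 ≤ √β₂ / β₁ := by positivity
  have hρ0 : 0 < ρ := by linarith
  -- If `α = 1` then `β₁ = 0`, and `√β₂ < β₁` is impossible.
  have hβ₂α : α = 1 → β₂ = 0 := by
    intro h1
    rcases hβ₂ with h2 | h2
    · exact h2
    · have := Real.sqrt_nonneg β₂
      linarith
  have hdT : (2 : ℝ) ≤ d * T := by
    have h1 : (1 : ℝ) ≤ d := by exact_mod_cast hd
    have h2 : (2 : ℝ) ≤ T := by exact_mod_cast hT2
    nlinarith
  have hlog : 2 ≤ d * T / δ := by rw [le_div_iff₀ hδ]; nlinarith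
  refine ofReal_one_sub_le_measure (measure_exists_abs_expAvg_runNoise_gt_le β₂ η x₁ hξ hlaw hind
    hf h.measurable_gradient hσ hβ₁0 hβ₁1 (T := T) hδ (by linarith)) (fun ω hω => ?_) hδ.le
  have hgood : ∀ j, ∀ k ∈ Finset.Icc 1 T,
      |expAvg β₁ (runNoise f F β₁ β₂ η x₁ (fun s => ξ s ω) j) k|
        ≤ σ j * √(2 * (1 - β₁) * Real.log (2 * (d * T) / δ)) := by
    intro j k hk
    by_contra hc
    exact hω ⟨j, k, hk, not_le.1 hc⟩
  set E : Fin d → ℝ := fun j => σ j * √(2 * α * Real.log (2 * (d * T) / δ)) with hE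
  have hE0 : ∀ j, 0 ≤ E j := fun j => mul_nonneg (hσ j).1.le (Real.sqrt_nonneg _)
  have hEn : l1Norm E = l1Norm σ * √(2 * α * Real.log (2 * (d * T) / δ)) := by
    simp only [l1Norm, hE, abs_mul, abs_of_nonneg (Real.sqrt_nonneg _), Finset.sum_mul]
  refine hp.rate_bound hβ₂0 hβ₂1 hβ₂α hρ0 hlog ?_
  rw [← hEn, hρ]
  refine signRun_min_le hp h hF hΔ hβ₁ hβ₂0 hβ₂1 hκ0 hκ1 hκβ
    (by rw [← hρ]; exact hp.drift_le hβ₂1 hρ0 hTle) hE0 (fun j s hs => ?_) (fun t ht => ?_)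
    (f := f) (x₁ := x₁) (ξ := fun s => ξ s ω)
  -- Time `0` lies outside the union bound, but the average vanishes there.
  · rcases Nat.eq_zero_or_pos s with rfl | hs0
    · simpa [expAvg] using hE0 j
    · have := hgood j s (Finset.mem_Icc.2 ⟨hs0, hs⟩)
      rwa [hβ₁, sub_sub_cancel, ← hβ₁] at this
  · exact Finset.inf'_le _ (Finset.mem_Icc.2 ⟨by omega, ht⟩ : t + 1 ∈ Finset.Icc 1 T)

/-- Convergence of generalized SignSGD, with an absolute constant `C`. -/
theorem theorem1 :
    ∃ C : ℝ, 0 < C ∧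
      ∀ (d : ℕ) (Ω Ξ : Type*) [MeasurableSpace Ω] [MeasurableSpace Ξ]
        (P : Measure Ω) [IsProbabilityMeasure P] (𝒟 : Measure Ξ) [IsProbabilityMeasure 𝒟]
        (ξ : ℕ → Ω → Ξ) (f : EuclideanSpace ℝ (Fin d) → Ξ → ℝ)
        (F : EuclideanSpace ℝ (Fin d) → ℝ) (L₀ L₁ σ : Fin d → ℝ)
        (x₁ : EuclideanSpace ℝ (Fin d)) (T : ℕ) (hT : 1 ≤ T)
        (Δ α β₁ β₂ ρ η δ : ℝ),
      -- the samples are independent with law `𝒟`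
      (∀ t, Measurable (ξ t)) → (∀ t, P.map (ξ t) = 𝒟) → iIndepFun ξ P →
      IsStochasticObjective 𝒟 f F →
      BddBelow (Set.range F) →
      0 < l1Norm L₀ →
      CoordSmooth L₀ L₁ F →
      BoundedNoise 𝒟 f F σ →
      -- the parameters
      F x₁ - (⨅ x, F x) ≤ Δ →
      α = min (√(l1Norm L₀) * √Δ / (l1Norm σ * √(T : ℝ))) 1 →
      β₁ = 1 - α →
      0 ≤ β₂ → (β₂ = 0 ∨ √β₂ < β₁) →
      ρ = 1 - √β₂ / β₁ →
      η = √(Δ * α) / (√(l1Norm L₀) * √(T : ℝ)) →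
      max (100 * d * Δ * ‖L₁‖ ^ 2 / ((1 - β₂) * ρ ^ 2 * l1Norm L₀))
          (10000 * d ^ 2 * Δ * l1Norm σ ^ 2 * ‖L₁‖ ^ 4
            / ((1 - β₂) ^ 2 * ρ ^ 4 * l1Norm L₀ ^ 3)) ≤ (T : ℝ) →
      0 < δ → δ < 1 →
      -- the general guarantee
      ((∀ j, BddAbove (sublevelPartials F x₁ j)) →
        ENNReal.ofReal (1 - δ) ≤ P {ω |
          (Finset.Icc 1 T).inf' (Finset.nonempty_Icc.mpr hT)
            (fun t => l1Norm (gradient F (signIter f β₁ β₂ η x₁ (fun s => ξ s ω) t)).ofLp)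
          ≤ C * (√(Real.log (d * T / δ)) * l1Norm L₀ ^ (1 / 4 : ℝ) * Δ ^ (1 / 4 : ℝ)
                    * l1Norm σ ^ (1 / 2 : ℝ) / (ρ * √(1 - β₂) * (T : ℝ) ^ (1 / 4 : ℝ))
                + Real.log (d * T / δ) * √(l1Norm L₀ * Δ) / (ρ * √(T : ℝ)))
            + C * ((l1Norm (sublevelBound F x₁) + l1Norm σ) / ρ
                    * expNegDiv
                        (√(1 - β₂) * l1Norm L₀ ^ (3 / 4 : ℝ) * (T : ℝ) ^ (1 / 4 : ℝ))
                        (√(d : ℝ) * ‖L₁‖ * l1Norm σ ^ (1 / 2 : ℝ) * Δ ^ (1 / 4 : ℝ))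
                + l1Norm (gradient F x₁).ofLp / T)}) ∧
      -- the refined guarantee for SignSGD with momentum
      (β₂ = 0 →
        ENNReal.ofReal (1 - δ) ≤ P {ω |
          (Finset.Icc 1 T).inf' (Finset.nonempty_Icc.mpr hT)
            (fun t => l1Norm (gradient F (signIter f β₁ β₂ η x₁ (fun s => ξ s ω) t)).ofLp)
          ≤ C * (√(Real.log (d * T / δ)) * l1Norm L₀ ^ (1 / 4 : ℝ) * Δ ^ (1 / 4 : ℝ)
                    * l1Norm σ ^ (1 / 2 : ℝ) / (T : ℝ) ^ (1 / 4 : ℝ)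
                + Real.log (d * T / δ) * √(l1Norm L₀ * Δ) / √(T : ℝ))
            + C * (l1Norm (gradient F x₁).ofLp / √(T : ℝ)
                    * (1 / √(T : ℝ) + l1Norm σ / √(l1Norm L₀ * Δ))
                + l1Norm σ / T)}) := by

  refine ⟨2000, by norm_num, ?_⟩
  intro d Ω Ξ _ _ P _ 𝒟 _ ξ f F L₀ L₁ σ x₁ T hT Δ α β₁ β₂ ρ η δ hξ hlaw hind hf hF hL₀ h hσ hΔ
    hα hβ₁ hβ₂0 hβ₂ hρ hη hTle hδ hδ1
  have hd : 1 ≤ d := by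
    rcases Nat.eq_zero_or_pos d with rfl | hd
    · simp [l1Norm] at hL₀
    · exact hd
  have hT0 : (1 : ℝ) ≤ T := by exact_mod_cast hT
  have hlog : 0 ≤ Real.log (d * T / δ) := by
    have h1 : (1 : ℝ) ≤ d := by exact_mod_cast hd
    refine Real.log_nonneg ?_
    rw [le_div_iff₀ hδ]; nlinarith
  have hΔ0 : 0 ≤ Δ := by have := ciInf_le hF x₁; linarith
  have hρ0 : 0 < ρ := by
    rw [hρ, sub_pos]
    rcases hβ₂ with h2 | h2
    · simp [h2]
    · exact (div_lt_one ((Real.sqrt_nonneg _).trans_lt h2)).2 h2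
  have hS := l1Norm_nonneg σ
  have hM := l1Norm_nonneg (sublevelBound F x₁)
  have hG := l1Norm_nonneg (gradient F x₁).ofLp
  have hexp := expNegDiv_nonneg (√(1 - β₂) * l1Norm L₀ ^ (3 / 4 : ℝ) * (T : ℝ) ^ (1 / 4 : ℝ))
    (√(d : ℝ) * ‖L₁‖ * l1Norm σ ^ (1 / 2 : ℝ) * Δ ^ (1 / 4 : ℝ))
  have hmain : 0 ≤ √(Real.log (d * T / δ)) * l1Norm L₀ ^ (1 / 4 : ℝ) * Δ ^ (1 / 4 : ℝ)
            * l1Norm σ ^ (1 / 2 : ℝ) / (ρ * √(1 - β₂) * (T : ℝ) ^ (1 / 4 : ℝ))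
          + Real.log (d * T / δ) * √(l1Norm L₀ * Δ) / (ρ * √(T : ℝ)) := by positivity
  have hterm : 0 ≤ (l1Norm (sublevelBound F x₁) + l1Norm σ) / ρ
      * expNegDiv (√(1 - β₂) * l1Norm L₀ ^ (3 / 4 : ℝ) * (T : ℝ) ^ (1 / 4 : ℝ))
        (√(d : ℝ) * ‖L₁‖ * l1Norm σ ^ (1 / 2 : ℝ) * Δ ^ (1 / 4 : ℝ)) := by positivity
  have hterm' : 0 ≤ l1Norm (gradient F x₁).ofLp / T := by positivity
  have htermb : 0 ≤ l1Norm (gradient F x₁).ofLp / √(T : ℝ)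
      * (1 / √(T : ℝ) + l1Norm σ / √(l1Norm L₀ * Δ)) + l1Norm σ / T := by positivity
  -- With `d = T = 1` the logarithm can be arbitrarily small, so `T = 1` is left to the term
  -- `‖∇F(x₁)‖₁ / T`. For `Δ = 0` the starting point is a minimizer.
  by_cases hcase : 2 ≤ T ∧ 0 < Δ
  · have key := signIter_min_le_with_high_probability hT hcase.1 hξ hlaw hind hf hF hL₀ h hσ hΔ
      hcase.2 hα hβ₁ hβ₂0 hβ₂ hρ hη hTle hδ hδ1
    refine ⟨fun _ => key.trans (measure_mono fun ω hω => ?_),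
      fun hβ => key.trans (measure_mono fun ω hω => ?_)⟩
    · rw [Set.mem_ofPred_eq] at hω ⊢
      refine hω.trans ?_
      linarith
    · rw [Set.mem_ofPred_eq] at hω ⊢
      refine hω.trans ?_
      have hρ1 : ρ = 1 := by rw [hρ, hβ]; simp
      rw [hρ1, hβ]
      simp only [sub_zero, Real.sqrt_one, mul_one, one_mul]
      linarith
  · have hsmall : l1Norm (gradient F x₁).ofLp ≤ l1Norm (gradient F x₁).ofLp / T := by
      rcases not_and_or.1 hcase with h2 | h2
      · have : T = 1 := by omega
        simp [this]
      · have hz := gradient_eq_zero_of_eq_iInf (x := x₁) hF (by linarith)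
        simp [hz, l1Norm]
    have hsmallb : l1Norm (gradient F x₁).ofLp / T ≤ l1Norm (gradient F x₁).ofLp / √(T : ℝ)
        * (1 / √(T : ℝ) + l1Norm σ / √(l1Norm L₀ * Δ)) + l1Norm σ / T := by
      have e : l1Norm (gradient F x₁).ofLp / √(T : ℝ) * (1 / √(T : ℝ))
          = l1Norm (gradient F x₁).ofLp / T := by
        rw [div_mul_div_comm, mul_one, Real.mul_self_sqrt (by linarith)]
      have e2 : 0 ≤ l1Norm (gradient F x₁).ofLp / √(T : ℝ) * (l1Norm σ / √(l1Norm L₀ * Δ)) := by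
        positivity
      have e3 : 0 ≤ l1Norm σ / T := by positivity
      rw [mul_add, e]; linarith
    have hinf : ∀ ω, (Finset.Icc 1 T).inf' (Finset.nonempty_Icc.mpr hT)
        (fun t => l1Norm (gradient F (signIter f β₁ β₂ η x₁ (fun s => ξ s ω) t)).ofLp)
        ≤ l1Norm (gradient F x₁).ofLp := fun ω =>
      Finset.inf'_le _ (Finset.mem_Icc.2 ⟨le_rfl, hT⟩ : 1 ∈ Finset.Icc 1 T)
    have hall : ∀ {S : Set Ω}, (∀ ω, ω ∈ S) → ENNReal.ofReal (1 - δ) ≤ P S := fun hS => by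
      rw [Set.eq_univ_of_forall hS, measure_univ]
      exact ENNReal.ofReal_le_one.2 (by linarith)
    refine ⟨fun _ => hall fun ω => (hinf ω).trans ?_, fun hβ => hall fun ω => (hinf ω).trans ?_⟩
    · linarith
    · have hρ1 : ρ = 1 := by rw [hρ, hβ]; simp
      rw [hρ1, hβ] at hmain
      simp only [sub_zero, Real.sqrt_one, mul_one, one_mul] at hmain
      linarith
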